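/- For $s\ge 0$ and $f\in L^2(\mathbb R)$ put $\|f\|_s=\|(1+\xi^2)^{s/2}\hat f(\xi)\|_{L^2}$ (unitary Fourier transform), with value $\infty$ if $f$ is not in the Sobolev space $H^s(\mathbb R)$. For $0<\delta\le 1$ and $s\ge 2$ put $$\|f\|_{(\delta,s)}=\sup_{k\ge 0}\frac{\delta^k(k+1)^2\,\|f^{(k)}\|_s}{k!},\qquad E_{\delta,s}=\{f\in C^\infty(\mathbb R):\ \|f\|_{(\delta,s)}<\infty\},$$ the functions being real-valued, and let $E_{\delta,s}^{\mathbb C}$ be the corresponding normed space of complex-valued functions (the complexification of $E_{\delta,s}$). Let $\Lambda^{-2}=(1-\partial_x^2)^{-1}$, that is, the Fourier multiplier with symbol $(1+\xi^2)^{-1}$. For $\alpha,\beta\in\mathbb R$ consider the Cauchy problem $$\begin{cases} u_t+\beta u u_x+\Lambda^{-2}\partial_x\left[-\alpha u+\frac{3-\beta}{2}u^2+\frac{\beta}{2}u_x^2+v+\frac12 v^2\right]=0,\\ v_t+u_x+(uv)_x=0,\\ u(0,x)=u_0(x),\quad v(0,x)=v_0(x).\end{cases}$$ Write $D(0,r)=\{t\in\mathbb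 C: |t|<r\}$. **Theorem.** Let $\alpha,\beta\in\mathbb R$, $0<\Delta\le 1$, $s\ge 2$ and $(u_0,v_0)\in E_{\Delta,s+1}\oplus E_{\Delta,s+1}$. Then there are $T_\Delta>0$ and functions $u(t,\cdot)$, $v(t,\cdot)$, defined for $t\in D(0,T_\Delta)$ and real-valued for real $t$, such that for every $d\in(0,1)$ the restriction of $(u,v)$ to the disk $D(0,T_\Delta(1-d))$ is a holomorphic function of $t$ with values in $E^{\mathbb C}_{\Delta d,s+1}\oplus E^{\mathbb C}_{\Delta d,s+1}$ which solves the Cauchy problem there, and it is the only such function: every holomorphic function on $D(0,T_\Delta(1-d))$ with values in $E^{\mathbb C}_{\Delta d,s+1}\oplus E^{\mathbb C}_{\Delta d,s+1}$ that solves the Cauchy problem coincides with it on that disk. -/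

import Mathlib

open MeasureTheory Set
open scoped ENNReal ContDiff FourierTransform

noncomputable section

namespace CamassaHolm

/-- The Fourier transform of a square-integrable function `ℝ → ℂ`, as an `L²` function, in Mathlib's
normalization `f̂(ξ) = ∫ e^{-2πixξ} f(x) dx`; the frequency of `e^{2πixξ}` is `2πξ`. The value on
functions that are not square-integrable is irrelevant. -/
def l2Fourier (f : ℝ → ℂ) : ℝ → ℂ :=
  open Classical in
  if h : MemLp f 2 volume then ((𝓕 (h.toLp f) : Lp ℂ 2 (volume : Measure ℝ)) : ℝ → ℂ) else 0

/-- The symbol `(1 + (2πξ)²)^{s/2}` of `Λ^s = (1 - ∂ₓ²)^{s/2}`. -/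
def besselWeight (s ξ : ℝ) : ℝ := (1 + (2 * Real.pi * ξ) ^ 2) ^ (s / 2)

/-- The Sobolev norm `‖f‖_s = ‖Λ^s f‖_{L²}`, with values in `[0, ∞]`; it is infinite for functions
outside `L²` (it is used for `s ≥ 0` only, where `H^s ⊆ L²`). -/
def sobolevENorm (s : ℝ) (f : ℝ → ℂ) : ℝ≥0∞ :=
  open Classical in
  if MemLp f 2 volume then eLpNorm (fun ξ => (besselWeight s ξ : ℂ) * l2Fourier f ξ) 2 volume
  else ⊤

/-- The norm `sup_k δ^k (k+1)² ‖f^{(k)}‖_s / k!`, with values in `[0, ∞]`. -/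
def eNormE (δ s : ℝ) (f : ℝ → ℂ) : ℝ≥0∞ :=
  ⨆ k : ℕ, ENNReal.ofReal (δ ^ k * ((k : ℝ) + 1) ^ 2 / (k.factorial : ℝ)) *
    sobolevENorm s (iteratedDeriv k f)

/-- Membership in (the complexification of) `E_{δ,s}`: smooth functions of finite norm. -/
def MemE (δ s : ℝ) (f : ℝ → ℂ) : Prop := ContDiff ℝ ∞ f ∧ eNormE δ s f < ⊤

/-- `Λ^{-2} = (1 - ∂ₓ²)^{-1}` on `L²`: the Fourier multiplier with symbol `(1 + (2πξ)²)^{-1}`. Since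
the product of the symbol with an `L²` function is integrable, the inverse Fourier integral
`∫ e^{2πixξ} (1 + (2πξ)²)^{-1} f̂(ξ) dξ` converges absolutely for every `x`. -/
def invHelmholtz (f : ℝ → ℂ) : ℝ → ℂ :=
  𝓕⁻ (fun ξ : ℝ => (((1 + (2 * Real.pi * ξ) ^ 2)⁻¹ : ℝ) : ℂ) * l2Fourier f ξ)

/-! ### The norm of `E_{δ,s}` -/

lemma besselWeight_pos (s ξ : ℝ) : 0 < besselWeight s ξ := by
  unfold besselWeight; positivity

lemma measurable_besselWeight (s : ℝ) : Measurable (besselWeight s) := by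
  unfold besselWeight; fun_prop

lemma l2Fourier_of_memLp {f : ℝ → ℂ} (h : MemLp f 2 volume) :
    l2Fourier f = ((𝓕 (h.toLp f) : Lp ℂ 2 (volume : Measure ℝ)) : ℝ → ℂ) := by
  rw [l2Fourier, dif_pos h]

lemma aestronglyMeasurable_weight_mul (s : ℝ) {f : ℝ → ℂ} (h : MemLp f 2 volume) :
    AEStronglyMeasurable (fun ξ => (besselWeight s ξ : ℂ) * l2Fourier f ξ) volume := by
  rw [l2Fourier_of_memLp h]
  exact (Complex.measurable_ofReal.comp (measurable_besselWeight s)).aestronglyMeasurable.mul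
    (Lp.aestronglyMeasurable _)

lemma l2Fourier_add {f g : ℝ → ℂ} (hf : MemLp f 2 volume) (hg : MemLp g 2 volume) :
    l2Fourier (f + g) =ᵐ[volume] l2Fourier f + l2Fourier g := by
  rw [l2Fourier_of_memLp hf, l2Fourier_of_memLp hg, l2Fourier_of_memLp (hf.add hg),
    MemLp.toLp_add, FourierTransform.fourier_add]
  exact Lp.coeFn_add _ _

lemma l2Fourier_smul (c : ℂ) {f : ℝ → ℂ} (hf : MemLp f 2 volume) :
    l2Fourier (c • f) =ᵐ[volume] c • l2Fourier f := by
  rw [l2Fourier_of_memLp hf, l2Fourier_of_memLp (hf.const_smul c),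
    MemLp.toLp_const_smul, FourierTransform.fourier_smul]
  exact Lp.coeFn_smul _ _

lemma sobolevENorm_add_le (s : ℝ) (f g : ℝ → ℂ) :
    sobolevENorm s (f + g) ≤ sobolevENorm s f + sobolevENorm s g := by
  by_cases hf : MemLp f 2 volume
  · by_cases hg : MemLp g 2 volume
    · rw [sobolevENorm, sobolevENorm, sobolevENorm, if_pos hf, if_pos hg, if_pos (hf.add hg)]
      refine le_trans (le_of_eq (eLpNorm_congr_ae ?_)) (eLpNorm_add_le
        (aestronglyMeasurable_weight_mul s hf) (aestronglyMeasurable_weight_mul s hg) (by norm_num))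
      filter_upwards [l2Fourier_add hf hg] with ξ h
      rw [h]; simp only [Pi.add_apply]; ring
    · simp [sobolevENorm, hg]
  · simp [sobolevENorm, hf]

lemma sobolevENorm_smul (s : ℝ) (c : ℂ) (f : ℝ → ℂ) :
    sobolevENorm s (c • f) = ‖c‖ₑ * sobolevENorm s f := by
  by_cases hf : MemLp f 2 volume
  · rw [sobolevENorm, sobolevENorm, if_pos hf, if_pos (hf.const_smul c), ← eLpNorm_const_smul]
    refine eLpNorm_congr_ae ?_
    filter_upwards [l2Fourier_smul c hf] with ξ h
    rw [h]; simp only [Pi.smul_apply, smul_eq_mul]; ring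
  · rcases eq_or_ne c 0 with rfl | hc
    · have h0 : MemLp (0 : ℝ → ℂ) 2 volume := MemLp.zero
      have h := l2Fourier_smul 0 h0
      rw [zero_smul, enorm_zero, zero_mul, sobolevENorm, if_pos h0]
      rw [zero_smul, zero_smul] at h
      rw [eLpNorm_congr_ae (g := 0), eLpNorm_zero]
      filter_upwards [h] with ξ h
      simp [h]
    · have h : ¬ MemLp (c • f) 2 volume := fun h => hf (by
        simpa [smul_smul, hc] using h.const_smul c⁻¹)
      rw [sobolevENorm, sobolevENorm, if_neg hf, if_neg h, ENNReal.mul_top (by simpa using hc)]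

lemma eq_zero_of_sobolevENorm {s : ℝ} {f : ℝ → ℂ} (hc : Continuous f)
    (h : sobolevENorm s f = 0) : f = 0 := by
  by_cases hf : MemLp f 2 volume
  · rw [sobolevENorm, if_pos hf,
      eLpNorm_eq_zero_iff (aestronglyMeasurable_weight_mul s hf) (by norm_num),
      l2Fourier_of_memLp hf] at h
    have h1 : (𝓕 (hf.toLp f) : Lp ℂ 2 (volume : Measure ℝ)) = 0 := by
      rw [Lp.eq_zero_iff_ae_eq_zero]
      filter_upwards [h] with ξ hξ
      have := (besselWeight_pos s ξ).ne'
      simpa [this] using hξ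
    have h2 : hf.toLp f = 0 := by
      rw [← norm_eq_zero, ← Lp.norm_fourier_eq, h1, norm_zero]
    have h3 : f =ᵐ[volume] (0 : ℝ → ℂ) := by
      rw [Lp.eq_zero_iff_ae_eq_zero] at h2
      exact hf.coeFn_toLp.symm.trans h2
    exact (hc.ae_eq_iff_eq volume continuous_zero).1 h3
  · simp [sobolevENorm, hf] at h

lemma eNormE_add_le {δ s : ℝ} {f g : ℝ → ℂ} (hf : ContDiff ℝ ∞ f) (hg : ContDiff ℝ ∞ g) :
    eNormE δ s (f + g) ≤ eNormE δ s f + eNormE δ s g := by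
  refine iSup_le fun k => ?_
  have hk : iteratedDeriv k (f + g) = iteratedDeriv k f + iteratedDeriv k g := by
    ext x
    exact iteratedDeriv_add (hf.of_le (by exact_mod_cast le_top)).contDiffAt
      (hg.of_le (by exact_mod_cast le_top)).contDiffAt
  rw [hk]
  refine (mul_le_mul_right (sobolevENorm_add_le s _ _) _).trans ?_
  rw [mul_add]
  exact add_le_add
    (le_iSup (fun k : ℕ => ENNReal.ofReal (δ ^ k * ((k : ℝ) + 1) ^ 2 / (k.factorial : ℝ)) *
      sobolevENorm s (iteratedDeriv k f)) k)
    (le_iSup (fun k : ℕ => ENNReal.ofReal (δ ^ k * ((k : ℝ) + 1) ^ 2 / (k.factorial : ℝ)) *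
      sobolevENorm s (iteratedDeriv k g)) k)

lemma eNormE_smul {δ s : ℝ} (c : ℂ) {f : ℝ → ℂ} (hf : ContDiff ℝ ∞ f) :
    eNormE δ s (c • f) = ‖c‖ₑ * eNormE δ s f := by
  rw [eNormE, eNormE, ENNReal.mul_iSup]
  refine iSup_congr fun k => ?_
  have hk : iteratedDeriv k (c • f) = c • iteratedDeriv k f := by
    ext x
    exact iteratedDeriv_const_smul (hf.of_le (by exact_mod_cast le_top)).contDiffAt c
  rw [hk, sobolevENorm_smul]
  ring

lemma eq_zero_of_eNormE {δ s : ℝ} {f : ℝ → ℂ} (hf : ContDiff ℝ ∞ f) (h : eNormE δ s f = 0) :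
    f = 0 := by
  rw [eNormE, ENNReal.iSup_eq_zero] at h
  have h0 := h 0
  simp only [pow_zero, Nat.cast_zero, zero_add, one_pow, mul_one, Nat.factorial_zero,
    Nat.cast_one, div_one, ENNReal.ofReal_one, one_mul, iteratedDeriv_zero] at h0
  exact eq_zero_of_sobolevENorm hf.continuous h0

/-- `E_{δ,s}` as a linear subspace of the space of functions. -/
def submoduleE (δ s : ℝ) : Submodule ℂ (ℝ → ℂ) where
  carrier := {f | MemE δ s f}
  add_mem' := fun hf hg => ⟨hf.1.add hg.1,
    (eNormE_add_le hf.1 hg.1).trans_lt (ENNReal.add_lt_top.2 ⟨hf.2, hg.2⟩)⟩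
  zero_mem' := by
    refine ⟨contDiff_const, ?_⟩
    have h := eNormE_smul (δ := δ) (s := s) 0 (contDiff_const (c := (0 : ℂ)) : ContDiff ℝ ∞ _)
    rw [zero_smul, enorm_zero, zero_mul] at h
    rw [h]
    exact ENNReal.zero_lt_top
  smul_mem' := fun c f hf => ⟨hf.1.const_smul c, by
    rw [eNormE_smul c hf.1]
    exact ENNReal.mul_lt_top enorm_lt_top hf.2⟩

/-- The normed space `E_{δ,s}` of complex-valued functions on the real line. -/
def E (δ s : ℝ) : Type := submoduleE δ s

instance (δ s : ℝ) : AddCommGroup (E δ s) := inferInstanceAs (AddCommGroup (submoduleE δ s))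

instance (δ s : ℝ) : Module ℂ (E δ s) := inferInstanceAs (Module ℂ (submoduleE δ s))

instance (δ s : ℝ) : CoeFun (E δ s) (fun _ => ℝ → ℂ) := ⟨fun f => f.1⟩

instance (δ s : ℝ) : Norm (E δ s) := ⟨fun f => (eNormE δ s f).toReal⟩

lemma coreE (δ s : ℝ) : NormedSpace.Core ℂ (E δ s) where
  norm_nonneg _ := ENNReal.toReal_nonneg
  norm_smul c f := by
    change (eNormE δ s (c • (f : ℝ → ℂ))).toReal = _
    rw [eNormE_smul c f.2.1, ENNReal.toReal_mul, toReal_enorm]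
    rfl
  norm_triangle f g := by
    change (eNormE δ s ((f : ℝ → ℂ) + (g : ℝ → ℂ))).toReal ≤ _
    refine (ENNReal.toReal_mono (ENNReal.add_lt_top.2 ⟨f.2.2, g.2.2⟩).ne
      (eNormE_add_le f.2.1 g.2.1)).trans ?_
    rw [ENNReal.toReal_add f.2.2.ne g.2.2.ne]
    rfl
  norm_eq_zero_iff f := by
    change (eNormE δ s f).toReal = 0 ↔ _
    rw [ENNReal.toReal_eq_zero_iff]
    constructor
    · rintro (h | h)
      · exact Subtype.ext (eq_zero_of_eNormE f.2.1 h)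
      · exact absurd h f.2.2.ne
    · rintro rfl
      left
      have h := eNormE_smul (δ := δ) (s := s) 0 (contDiff_const (c := (0 : ℂ)) : ContDiff ℝ ∞ _)
      rw [zero_smul, enorm_zero, zero_mul] at h
      exact h

instance (δ s : ℝ) : NormedAddCommGroup (E δ s) := NormedAddCommGroup.ofCore (coreE δ s)

instance (δ s : ℝ) : NormedSpace ℂ (E δ s) := NormedSpace.ofCore (coreE δ s)

/-! ### The Cauchy problem -/

/-- The nonlocal term `Λ^{-2} ∂ₓ [-α u + (3-β)/2 u² + β/2 uₓ² + v + v²/2]`. -/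
def nonlocalTerm (α β : ℝ) (u v : ℝ → ℂ) : ℝ → ℂ :=
  invHelmholtz (deriv fun x : ℝ =>
    -(α : ℂ) * u x + (3 - (β : ℂ)) / 2 * u x ^ 2 + (β : ℂ) / 2 * deriv u x ^ 2 + v x
      + 1 / 2 * v x ^ 2)

/-- `U = (u, v)` is a holomorphic function on the disk `|t| < r` with values in
`E_{δ,s} ⊕ E_{δ,s}` which solves there the Cauchy problem
`uₜ + β u uₓ + Λ^{-2} ∂ₓ [-α u + (3-β)/2 u² + β/2 uₓ² + v + v²/2] = 0`,
`vₜ + uₓ + (u v)ₓ = 0`, `u(0, ·) = u₀`, `v(0, ·) = v₀`. The time derivative is the complex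
derivative in the normed space. -/
structure IsHolomorphicSolution (α β δ s r : ℝ) (u₀ v₀ : ℝ → ℝ) (U : ℂ → E δ s × E δ s) :
    Prop where
  holomorphic : DifferentiableOn ℂ U (Metric.ball 0 r)
  eq_u : ∀ t ∈ Metric.ball (0 : ℂ) r, ∀ x : ℝ,
    (deriv U t).1 x + (β : ℂ) * (U t).1 x * deriv (U t).1 x
      + nonlocalTerm α β (U t).1 (U t).2 x = 0
  eq_v : ∀ t ∈ Metric.ball (0 : ℂ) r, ∀ x : ℝ,
    (deriv U t).2 x + deriv (U t).1 x + deriv (fun y : ℝ => (U t).1 y * (U t).2 y) x = 0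
  init_u : ∀ x : ℝ, (U 0).1 x = (u₀ x : ℂ)
  init_v : ∀ x : ℝ, (U 0).2 x = (v₀ x : ℂ)

end CamassaHolm

end

noncomputable section

namespace CamassaHolm

open Finset.HasAntidiagonal (antidiagonal)

/-! ### Weighted norms on the Fourier side -/

/-! The solution is its Taylor series in time. Since `u uₓ = (u²/2)ₓ`, inserting power series into
the system gives a recursion in which the coefficient of order `n + 1` is `-1/(n + 1)` times a
quadratic expression in the coefficients of order at most `n`. The initial values therefore
determine exactly one formal solution (`exists_isFormalSolution`, `IsFormalSolution.unique`). As a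
holomorphic function with values in a Banach space is the sum of its Taylor series on the whole
disk, being a holomorphic solution is the same as having Taylor coefficients that satisfy the
recursion (`isHolomorphicSolution_iff`). Uniqueness follows at once, and existence reduces to
bounding the coefficients.

That bound is `IsFormalSolution.bddE`, proved by induction on `n` for all `d` in `(0, 1)`
simultaneously: both coefficients have norm at most `R (n + 1)⁻² (K / (1 - d))^n` in `E_{Δd,s+1}`.
The recursion loses one space derivative, which costs `1 / (δ - δ')` when the radius drops from `δ`
to `δ'` (`BddE.deriv`). Using the induction hypothesis at `d' = d + (1 - d)/(n + 2)` makes this cost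
of order `n / (1 - d)`. The prefactor `1/(n + 1)` absorbs the `n`, and passing from `1 - d'` to `1 -
d` in the `n`-th power costs only a bounded factor. The series then converges in `E_{Δd,s+1}` for
`|t| < (1 - d)/K`, so `T = 1/K` serves every `d`.

Products are controlled because `E_{δ,σ}` is an algebra (`BddE.mul`): `H^σ` is one for `σ ≥ 1`, and
the weights `(k + 1)⁻²` are stable under convolution. The same stability in the time index handles
the Cauchy products. The nonlocal bracket contains `uₓ` and is estimated only in order `s`; `Λ^{-2}
∂ₓ` gives the order back without loss of radius (`BddE.invHelmholtz_deriv`). The Sobolev facts are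
proved on the Fourier side, where a continuous function of `H^σ`, `σ ≥ 1`, is the absolutely
convergent inverse Fourier integral of its transform (`hasSpectrum_l2Fourier`). -/

/-- The weighted `L²` norm `‖(1 + (2πξ)²)^{σ/2} g‖_{L²}`. -/
def weightedENorm (σ : ℝ) (g : ℝ → ℂ) : ℝ≥0∞ :=
  eLpNorm (fun ξ => (besselWeight σ ξ : ℂ) * g ξ) 2 volume

lemma continuous_besselWeight (σ : ℝ) : Continuous (besselWeight σ) := by
  unfold besselWeight
  refine Continuous.rpow_const (by fun_prop) fun ξ => Or.inl ?_
  positivity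

lemma besselWeight_mono {σ τ : ℝ} (h : σ ≤ τ) (ξ : ℝ) : besselWeight σ ξ ≤ besselWeight τ ξ := by
  unfold besselWeight
  exact Real.rpow_le_rpow_of_exponent_le (by nlinarith [sq_nonneg (2 * Real.pi * ξ)]) (by linarith)

lemma besselWeight_add (σ τ ξ : ℝ) :
    besselWeight (σ + τ) ξ = besselWeight σ ξ * besselWeight τ ξ := by
  unfold besselWeight
  rw [add_div, Real.rpow_add (by positivity)]

lemma besselWeight_zero (ξ : ℝ) : besselWeight 0 ξ = 1 := by simp [besselWeight]

lemma besselWeight_two (ξ : ℝ) : besselWeight 2 ξ = 1 + (2 * Real.pi * ξ) ^ 2 := by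
  simp [besselWeight]

lemma besselWeight_one_sq (ξ : ℝ) : besselWeight 1 ξ ^ 2 = 1 + (2 * Real.pi * ξ) ^ 2 := by
  rw [sq, ← besselWeight_add, ← besselWeight_two]; norm_num

lemma abs_le_besselWeight_one (ξ : ℝ) : |2 * Real.pi * ξ| ≤ besselWeight 1 ξ := by
  refine abs_le_of_sq_le_sq ?_ (besselWeight_pos 1 ξ).le
  rw [besselWeight_one_sq]; linarith

lemma norm_ofReal_besselWeight (σ ξ : ℝ) : ‖(besselWeight σ ξ : ℂ)‖ = besselWeight σ ξ := by
  rw [Complex.norm_real, Real.norm_of_nonneg (besselWeight_pos σ ξ).le]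

lemma aestronglyMeasurable_ofReal_besselWeight_mul (σ : ℝ) {g : ℝ → ℂ}
    (hg : AEStronglyMeasurable g volume) :
    AEStronglyMeasurable (fun ξ => (besselWeight σ ξ : ℂ) * g ξ) volume :=
  (Complex.measurable_ofReal.comp (measurable_besselWeight σ)).aestronglyMeasurable.mul hg

lemma weightedENorm_congr {σ : ℝ} {g h : ℝ → ℂ} (e : g =ᵐ[volume] h) :
    weightedENorm σ g = weightedENorm σ h := by
  refine eLpNorm_congr_ae ?_
  filter_upwards [e] with ξ hξ
  rw [hξ]

/-- A multiplier bound `|m| w_σ ≤ w_τ` gives the corresponding bound of weighted norms. -/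
lemma weightedENorm_mul_le {σ τ : ℝ} {m : ℝ → ℂ} (g : ℝ → ℂ)
    (hm : ∀ ξ, ‖m ξ‖ * besselWeight σ ξ ≤ besselWeight τ ξ) :
    weightedENorm σ (fun ξ => m ξ * g ξ) ≤ weightedENorm τ g := by
  refine eLpNorm_mono fun ξ => ?_
  simp only [norm_mul, norm_ofReal_besselWeight]
  calc besselWeight σ ξ * (‖m ξ‖ * ‖g ξ‖) = ‖m ξ‖ * besselWeight σ ξ * ‖g ξ‖ := by ring
    _ ≤ _ := mul_le_mul_of_nonneg_right (hm ξ) (norm_nonneg _)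

lemma weightedENorm_mono {σ τ : ℝ} (h : σ ≤ τ) (g : ℝ → ℂ) :
    weightedENorm σ g ≤ weightedENorm τ g := by
  simpa using weightedENorm_mul_le (m := fun _ => 1) g
    (fun ξ => by simpa using besselWeight_mono h ξ)

/-- The symbol `2πiξ` of the derivative. -/
def derivSymbol (ξ : ℝ) : ℂ := 2 * Real.pi * Complex.I * ξ

lemma continuous_derivSymbol : Continuous derivSymbol := by unfold derivSymbol; fun_prop

lemma norm_derivSymbol (ξ : ℝ) : ‖derivSymbol ξ‖ = |2 * Real.pi * ξ| := by
  simp [derivSymbol, abs_mul]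

lemma weightedENorm_derivSymbol_mul_le (σ : ℝ) (g : ℝ → ℂ) :
    weightedENorm σ (fun ξ => derivSymbol ξ * g ξ) ≤ weightedENorm (σ + 1) g := by
  refine weightedENorm_mul_le g fun ξ => ?_
  rw [norm_derivSymbol, besselWeight_add, mul_comm]
  exact mul_le_mul_of_nonneg_left (abs_le_besselWeight_one ξ) (besselWeight_pos σ ξ).le

lemma memLp_of_weightedENorm {σ : ℝ} (hσ : 0 ≤ σ) {g : ℝ → ℂ} (hg : AEStronglyMeasurable g volume)
    (h : weightedENorm σ g < ⊤) : MemLp g 2 volume := by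
  refine ⟨hg, lt_of_le_of_lt ?_ ((weightedENorm_mono hσ g).trans_lt h)⟩
  simp [weightedENorm, besselWeight_zero]

/-- The constant of the embedding of the weighted `L²` space into `L¹`. -/
def sobolevConst : ℝ≥0∞ := eLpNorm (fun ξ => ((besselWeight 1 ξ)⁻¹ : ℝ)) 2 volume

lemma sobolevConst_lt_top : sobolevConst < ⊤ := by
  have hc : Continuous fun ξ => (besselWeight 1 ξ)⁻¹ :=
    (continuous_besselWeight 1).inv₀ fun ξ => (besselWeight_pos 1 ξ).ne'
  have h : MemLp (fun ξ => (besselWeight 1 ξ)⁻¹) 2 volume := by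
    rw [memLp_two_iff_integrable_sq hc.aestronglyMeasurable]
    simp only [inv_pow, besselWeight_one_sq]
    exact integrable_inv_one_add_sq.comp_mul_left' (R := 2 * Real.pi) (by positivity)
  exact h.2

/-- Cauchy–Schwarz against the reciprocal weight of order one, which is square-integrable because `∫
dξ / (1 + (2πξ)²)` is finite. This is the source of the condition `1 ≤ σ` throughout. -/
lemma eLpNorm_one_le {σ : ℝ} (hσ : 1 ≤ σ) {g : ℝ → ℂ} (hg : AEStronglyMeasurable g volume) :
    eLpNorm g 1 volume ≤ sobolevConst * weightedENorm σ g := by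
  have hc : Continuous fun ξ => (besselWeight 1 ξ)⁻¹ :=
    (continuous_besselWeight 1).inv₀ fun ξ => (besselWeight_pos 1 ξ).ne'
  have e : g = (fun ξ => (besselWeight 1 ξ)⁻¹) • fun ξ => (besselWeight 1 ξ : ℂ) * g ξ := by
    ext ξ
    have : (besselWeight 1 ξ : ℂ) ≠ 0 := by exact_mod_cast (besselWeight_pos 1 ξ).ne'
    simp only [Pi.smul_apply', Complex.real_smul, Complex.ofReal_inv]
    field_simp
  calc eLpNorm g 1 volume
      = eLpNorm ((fun ξ => (besselWeight 1 ξ)⁻¹) • fun ξ => (besselWeight 1 ξ : ℂ) * g ξ) 1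
          volume := by rw [← e]
    _ ≤ sobolevConst * weightedENorm 1 g :=
        eLpNorm_smul_le_mul_eLpNorm (p := 2) (q := 2) (r := 1)
          (aestronglyMeasurable_ofReal_besselWeight_mul 1 hg) hc.aestronglyMeasurable
    _ ≤ _ := by gcongr; exact weightedENorm_mono hσ g

lemma integrable_of_weightedENorm {σ : ℝ} (hσ : 1 ≤ σ) {g : ℝ → ℂ}
    (hg : AEStronglyMeasurable g volume) (h : weightedENorm σ g < ⊤) : Integrable g volume :=
  memLp_one_iff_integrable.1
    ⟨hg, (eLpNorm_one_le hσ hg).trans_lt (ENNReal.mul_lt_top sobolevConst_lt_top h)⟩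

/-! ### Inverse Fourier integrals -/

lemma continuous_fourierInv {g : ℝ → ℂ} (hg : Integrable g volume) : Continuous (𝓕⁻ g) := by
  have h : Continuous (𝓕 g) := VectorFourier.fourierIntegral_continuous Real.continuous_fourierChar
    (by fun_prop) hg
  have e : 𝓕⁻ g = fun x => 𝓕 g (-x) := by
    ext x; exact Real.fourierInv_eq_fourier_neg g x
  rw [e]
  fun_prop

lemma enorm_fourierInv_le (g : ℝ → ℂ) (x : ℝ) : ‖𝓕⁻ g x‖ₑ ≤ eLpNorm g 1 volume := by
  rw [Real.fourierInv_eq, eLpNorm_one_eq_lintegral_enorm]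
  refine (enorm_integral_le_lintegral_enorm _).trans (le_of_eq ?_)
  congr with ξ
  rw [← ofReal_norm, ← ofReal_norm, Circle.norm_smul]

lemma hasDerivAt_fourierInv {g : ℝ → ℂ} (hg : Integrable g volume)
    (hg' : Integrable (fun ξ => derivSymbol ξ * g ξ) volume) (x : ℝ) :
    HasDerivAt (𝓕⁻ g) (𝓕⁻ (fun ξ => derivSymbol ξ * g ξ) x) x := by
  have e (h : ℝ → ℂ) : 𝓕⁻ h = fun x => 𝓕 h (-x) := by
    ext x; exact Real.fourierInv_eq_fourier_neg h x
  have h1 : Integrable (fun ξ : ℝ => ξ • g ξ) volume := by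
    refine (hg'.const_mul (2 * Real.pi * Complex.I)⁻¹).congr (ae_of_all _ fun ξ => ?_)
    have : (2 * Real.pi * Complex.I : ℂ) ≠ 0 := Complex.two_pi_I_ne_zero
    simp only [derivSymbol, Complex.real_smul]
    field_simp
  have h2 := (Real.hasDerivAt_fourier hg h1 (-x)).scomp x (hasDerivAt_neg x)
  rw [e, e]
  refine h2.congr_deriv ?_
  have : (fun ξ : ℝ => (-2 * Real.pi * Complex.I * ξ : ℂ) • g ξ)
      = (-1 : ℂ) • fun ξ => derivSymbol ξ * g ξ := by
    ext ξ; simp [derivSymbol]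
  rw [this]
  simp only [Real.fourier_eq, Pi.smul_apply, smul_comm _ (-1 : ℂ), integral_smul]
  simp

/-- The inverse Fourier integral of a function in `L¹ ∩ L²` is its `L²` inverse Fourier
transform. -/
lemma coeFn_fourierInv_toLp {g : ℝ → ℂ} (h1 : Integrable g volume) (h2 : MemLp g 2 volume) :
    ((𝓕⁻ (h2.toLp g) : Lp ℂ 2 (volume : Measure ℝ)) : ℝ → ℂ) =ᵐ[volume] 𝓕⁻ g := by
  refine ae_eq_of_integral_contDiff_smul_eq
    ((Lp.memLp (𝓕⁻ (h2.toLp g) : Lp ℂ 2 (volume : Measure ℝ))).locallyIntegrable (by norm_num))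
    (continuous_fourierInv h1).locallyIntegrable fun φ hφ hc => ?_
  have hc' : HasCompactSupport (Complex.ofRealCLM ∘ φ) := hc.comp_left rfl
  have hφ' : ContDiff ℝ ∞ (Complex.ofRealCLM ∘ φ) := by fun_prop
  set Φ : SchwartzMap ℝ ℂ := hc'.toSchwartzMap hφ' with hΦ
  have hΦv (x : ℝ) : Φ x = (φ x : ℂ) := rfl
  -- The `L²` transform agrees with the distributional one, so it can be moved onto the test
  -- function.
  have k1 := congrArg (fun T => T Φ) (Lp.fourierInv_toTemperedDistribution_eq (h2.toLp g))
  simp only [TemperedDistribution.fourierInv_apply, Lp.toTemperedDistribution_apply] at k1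
  have k2 : ∫ x, φ x • (𝓕⁻ (h2.toLp g) : Lp ℂ 2 (volume : Measure ℝ)) x
      = ∫ x, (𝓕⁻ Φ) x • (h2.toLp g : Lp ℂ 2 (volume : Measure ℝ)) x := by
    rw [k1]; rfl
  rw [k2]
  have k3 : ∫ x, (𝓕⁻ Φ) x • (h2.toLp g : Lp ℂ 2 (volume : Measure ℝ)) x
      = ∫ x, 𝓕⁻ (Φ : ℝ → ℂ) x • g x := by
    refine integral_congr_ae ?_
    filter_upwards [h2.coeFn_toLp] with x hx
    rw [hx, SchwartzMap.fourierInv_coe]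
  rw [k3]
  have k4 : ∫ x, φ x • 𝓕⁻ g x = ∫ x, Φ x • 𝓕⁻ g x := rfl
  rw [k4]
  -- Fubini gives the same transposition for the `L¹` integral; the pairing `-(innerₗ ℝ)` turns the
  -- Fourier integral into the inverse one.
  have := VectorFourier.integral_fourierIntegral_smul_eq_flip (μ := (volume : Measure ℝ))
    (ν := (volume : Measure ℝ)) (L := -(innerₗ ℝ)) (f := (Φ : ℝ → ℂ)) (g := g)
    Real.continuous_fourierChar (by fun_prop) Φ.integrable h1
  have e1 (h : ℝ → ℂ) : VectorFourier.fourierIntegral Real.fourierChar volume (-(innerₗ ℝ)) h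
      = 𝓕⁻ h := by
    ext x
    simp [Real.fourierInv_eq, VectorFourier.fourierIntegral]
  have e2 : (-(innerₗ ℝ)).flip = -(innerₗ ℝ) := by
    ext; simp
  rw [e2, e1, e1] at this
  exact this

lemma memLp_fourierInv {g : ℝ → ℂ} (h1 : Integrable g volume) (h2 : MemLp g 2 volume) :
    MemLp (𝓕⁻ g) 2 volume :=
  (memLp_congr_ae (coeFn_fourierInv_toLp h1 h2)).1 (Lp.memLp _)

lemma l2Fourier_fourierInv {g : ℝ → ℂ} (h1 : Integrable g volume) (h2 : MemLp g 2 volume) :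
    l2Fourier (𝓕⁻ g) =ᵐ[volume] g := by
  have e : (memLp_fourierInv h1 h2).toLp (𝓕⁻ g) = 𝓕⁻ (h2.toLp g) := by
    rw [← Lp.toLp_coeFn (𝓕⁻ (h2.toLp g) : Lp ℂ 2 (volume : Measure ℝ)) (Lp.memLp _)]
    exact (MemLp.toLp_eq_toLp_iff _ _).2 (coeFn_fourierInv_toLp h1 h2).symm
  rw [l2Fourier_of_memLp (memLp_fourierInv h1 h2), e, FourierTransform.fourier_fourierInv_eq]
  exact h2.coeFn_toLp

lemma measurable_l2Fourier (f : ℝ → ℂ) : Measurable (l2Fourier f) := by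
  unfold l2Fourier
  split_ifs
  · exact (Lp.stronglyMeasurable _).measurable
  · exact measurable_const

/-- `f` is the inverse Fourier integral of the measurable function `g`, which lies in the weighted
`L²` space of order `σ`. -/
structure HasSpectrum (σ : ℝ) (f g : ℝ → ℂ) : Prop where
  measurable : Measurable g
  lt_top : weightedENorm σ g < ⊤
  eq : f = 𝓕⁻ g

namespace HasSpectrum

variable {σ : ℝ} {f g : ℝ → ℂ}

lemma mono {τ : ℝ} (h : HasSpectrum σ f g) (hτ : τ ≤ σ) : HasSpectrum τ f g :=
  ⟨h.1, (weightedENorm_mono hτ g).trans_lt h.2, h.3⟩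

lemma integrable (h : HasSpectrum σ f g) (hσ : 1 ≤ σ) : Integrable g volume :=
  integrable_of_weightedENorm hσ h.1.aestronglyMeasurable h.2

lemma memLp_spectrum (h : HasSpectrum σ f g) (hσ : 1 ≤ σ) : MemLp g 2 volume :=
  memLp_of_weightedENorm (zero_le_one.trans hσ) h.1.aestronglyMeasurable h.2

lemma memLp (h : HasSpectrum σ f g) (hσ : 1 ≤ σ) : MemLp f 2 volume :=
  h.3 ▸ memLp_fourierInv (h.integrable hσ) (h.memLp_spectrum hσ)

lemma l2Fourier_eq (h : HasSpectrum σ f g) (hσ : 1 ≤ σ) : l2Fourier f =ᵐ[volume] g :=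
  h.3 ▸ l2Fourier_fourierInv (h.integrable hσ) (h.memLp_spectrum hσ)

lemma continuous (h : HasSpectrum σ f g) (hσ : 1 ≤ σ) : Continuous f :=
  h.3 ▸ continuous_fourierInv (h.integrable hσ)

lemma sobolevENorm_eq (h : HasSpectrum σ f g) (hσ : 1 ≤ σ) :
    sobolevENorm σ f = weightedENorm σ g := by
  rw [sobolevENorm, if_pos (h.memLp hσ)]
  exact weightedENorm_congr (h.l2Fourier_eq hσ)

lemma enorm_apply_le (h : HasSpectrum σ f g) (hσ : 1 ≤ σ) (x : ℝ) :
    ‖f x‖ₑ ≤ sobolevConst * sobolevENorm σ f := by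
  rw [h.sobolevENorm_eq hσ]
  refine le_trans ?_ (eLpNorm_one_le hσ h.1.aestronglyMeasurable)
  rw [h.3]
  exact enorm_fourierInv_le g x

lemma derivSymbol_mul (h : HasSpectrum (σ + 1) f g) :
    HasSpectrum σ (𝓕⁻ fun ξ => derivSymbol ξ * g ξ) (fun ξ => derivSymbol ξ * g ξ) :=
  ⟨continuous_derivSymbol.measurable.mul h.1,
    (weightedENorm_derivSymbol_mul_le σ g).trans_lt h.2, rfl⟩

lemma hasDerivAt (h : HasSpectrum (σ + 1) f g) (hσ : 1 ≤ σ) (x : ℝ) :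
    HasDerivAt f (𝓕⁻ (fun ξ => derivSymbol ξ * g ξ) x) x := by
  rw [h.3]
  exact hasDerivAt_fourierInv (h.integrable (by linarith)) (h.derivSymbol_mul.integrable hσ) x

lemma deriv (h : HasSpectrum (σ + 1) f g) (hσ : 1 ≤ σ) :
    HasSpectrum σ (deriv f) (fun ξ => derivSymbol ξ * g ξ) := by
  have e : _root_.deriv f = 𝓕⁻ fun ξ => derivSymbol ξ * g ξ :=
    funext fun x => (h.hasDerivAt hσ x).deriv
  rw [e]
  exact h.derivSymbol_mul

end HasSpectrum

lemma memLp_of_sobolevENorm {σ : ℝ} {f : ℝ → ℂ} (h : sobolevENorm σ f < ⊤) :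
    MemLp f 2 volume := by
  by_contra hf
  simp [sobolevENorm, hf] at h

/-- The inverse Fourier integral of `l2Fourier f` has the same `L²` transform as `f`, so the two
agree almost everywhere by injectivity; both are continuous, hence they agree everywhere. -/
lemma hasSpectrum_l2Fourier {σ : ℝ} (hσ : 1 ≤ σ) {f : ℝ → ℂ} (hc : Continuous f)
    (h : sobolevENorm σ f < ⊤) : HasSpectrum σ f (l2Fourier f) := by
  have hf := memLp_of_sobolevENorm h
  have h' : weightedENorm σ (l2Fourier f) < ⊤ := by
    rwa [sobolevENorm, if_pos hf] at h
  have hg : HasSpectrum σ (𝓕⁻ (l2Fourier f)) (l2Fourier f) :=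
    ⟨measurable_l2Fourier f, h', rfl⟩
  have e : (hg.memLp hσ).toLp _ = hf.toLp f := by
    refine (Lp.fourierTransformₗᵢ ℝ ℂ).injective (Lp.ext ?_)
    have := hg.l2Fourier_eq hσ
    rw [l2Fourier_of_memLp (hg.memLp hσ)] at this
    refine this.trans ?_
    rw [l2Fourier_of_memLp hf]
    rfl
  have e' := (MemLp.toLp_eq_toLp_iff _ _).1 e
  rw [((hg.continuous hσ).ae_eq_iff_eq volume hc).1 e'] at hg
  exact hg

lemma enorm_apply_le_sobolevENorm {σ : ℝ} (hσ : 1 ≤ σ) {f : ℝ → ℂ} (hc : Continuous f) (x : ℝ) :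
    ‖f x‖ₑ ≤ sobolevConst * sobolevENorm σ f := by
  rcases eq_or_ne (sobolevENorm σ f) ⊤ with h | h
  · rw [h]
    -- Since `0 * ⊤ = 0` in `ℝ≥0∞`, the infinite case needs the constant to be nonzero.
    rcases eq_or_ne sobolevConst 0 with h0 | h0
    · exfalso
      have hc : Continuous fun ξ => (besselWeight 1 ξ)⁻¹ :=
        (continuous_besselWeight 1).inv₀ fun ξ => (besselWeight_pos 1 ξ).ne'
      rw [sobolevConst, eLpNorm_eq_zero_iff hc.aestronglyMeasurable (by norm_num)] at h0
      have := congrFun ((hc.ae_eq_iff_eq volume continuous_zero).1 h0) 0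
      simp [(besselWeight_pos 1 0).ne'] at this
    · rw [ENNReal.mul_top h0]; exact le_top
  · exact (hasSpectrum_l2Fourier hσ hc h.lt_top).enorm_apply_le hσ x

lemma sobolevENorm_deriv_le {σ : ℝ} (hσ : 1 ≤ σ) {f : ℝ → ℂ} (hc : Continuous f) :
    sobolevENorm σ (deriv f) ≤ sobolevENorm (σ + 1) f := by
  rcases eq_or_ne (sobolevENorm (σ + 1) f) ⊤ with h | h
  · rw [h]; exact le_top
  · have hg := hasSpectrum_l2Fourier (by linarith) hc h.lt_top
    rw [(hg.deriv hσ).sobolevENorm_eq hσ, hg.sobolevENorm_eq (by linarith)]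
    exact weightedENorm_derivSymbol_mul_le σ _

/-! ### Young's inequality and the algebra property -/

lemma eLpNorm_two_sq {ε : Type*} [ENorm ε] (f : ℝ → ε) :
    eLpNorm f 2 volume ^ 2 = ∫⁻ x, ‖f x‖ₑ ^ 2 := by
  have := eLpNorm_nnreal_pow_eq_lintegral (μ := (volume : Measure ℝ)) (f := f) (p := 2)
    two_ne_zero
  simpa using this

lemma sq_lintegral_mul_le {f g : ℝ → ℝ≥0∞} (hf : Measurable f) (hg : Measurable g) :
    (∫⁻ x, f x * g x) ^ 2 ≤ (∫⁻ x, f x ^ 2) * ∫⁻ x, g x ^ 2 := by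
  have h := ENNReal.lintegral_mul_le_Lp_mul_Lq volume Real.HolderConjugate.two_two
    hf.aemeasurable hg.aemeasurable
  simp only [Pi.mul_apply, ENNReal.rpow_two] at h
  refine (pow_le_pow_left' h 2).trans (le_of_eq ?_)
  rw [mul_pow, ← ENNReal.rpow_two, ← ENNReal.rpow_two, ← ENNReal.rpow_mul, ← ENNReal.rpow_mul]
  norm_num

/-- Young's inequality `‖F * G‖₂ ≤ ‖F‖₂ ‖G‖₁` for nonnegative functions. -/
lemma eLpNorm_lintegral_conv_le {F G : ℝ → ℝ≥0∞} (hF : Measurable F) (hG : Measurable G) :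
    eLpNorm (fun x => ∫⁻ y, F y * G (x - y)) 2 volume ≤ eLpNorm F 2 volume * ∫⁻ y, G y := by
  have hsq : eLpNorm (fun x => ∫⁻ y, F y * G (x - y)) 2 volume ^ 2
      ≤ (eLpNorm F 2 volume * ∫⁻ y, G y) ^ 2 := by
    rw [mul_pow, eLpNorm_two_sq, eLpNorm_two_sq]
    simp only [enorm_eq_self]
    have h1 (x : ℝ) : (∫⁻ y, F y * G (x - y)) ^ 2
        ≤ (∫⁻ y, F y ^ 2 * G (x - y)) * ∫⁻ y, G y := by
      have e (z : ℝ≥0∞) : z ^ (1 / 2 : ℝ) * z ^ (1 / 2 : ℝ) = z := by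
        rw [← ENNReal.rpow_add_of_nonneg _ _ (by norm_num) (by norm_num)]; norm_num
      -- Cauchy–Schwarz with the splitting `F G = (F G^{1/2}) G^{1/2}`; integrating in `x` and
      -- applying Tonelli then gives Young's inequality.
      have h := sq_lintegral_mul_le (f := fun y => F y * G (x - y) ^ (1 / 2 : ℝ))
        (g := fun y => G (x - y) ^ (1 / 2 : ℝ)) (by fun_prop) (by fun_prop)
      have e1 (y : ℝ) : F y * G (x - y) ^ (1 / 2 : ℝ) * G (x - y) ^ (1 / 2 : ℝ)
          = F y * G (x - y) := by rw [mul_assoc, e]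
      have e2 (y : ℝ) : (F y * G (x - y) ^ (1 / 2 : ℝ)) ^ 2 = F y ^ 2 * G (x - y) := by
        rw [mul_pow, sq (G (x - y) ^ (1 / 2 : ℝ)), e]
      have e3 (y : ℝ) : (G (x - y) ^ (1 / 2 : ℝ)) ^ 2 = G (x - y) := by rw [sq, e]
      simp only [e1, e2, e3] at h
      rwa [lintegral_sub_left_eq_self G x] at h
    calc ∫⁻ x, (∫⁻ y, F y * G (x - y)) ^ 2
        ≤ ∫⁻ x, (∫⁻ y, F y ^ 2 * G (x - y)) * ∫⁻ y, G y := lintegral_mono h1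
      _ = (∫⁻ x, ∫⁻ y, F y ^ 2 * G (x - y)) * ∫⁻ y, G y := by
          rw [lintegral_mul_const]
          exact Measurable.lintegral_prod_right'
            (f := fun p : ℝ × ℝ => F p.2 ^ 2 * G (p.1 - p.2))
            (by fun_prop)
      _ = (∫⁻ y, ∫⁻ x, F y ^ 2 * G (x - y)) * ∫⁻ y, G y := by
          rw [lintegral_lintegral_swap]
          exact Measurable.aemeasurable (f := fun p : ℝ × ℝ => F p.2 ^ 2 * G (p.1 - p.2))
            (by fun_prop)
      _ = (∫⁻ y, F y ^ 2 * ∫⁻ x, G x) * ∫⁻ y, G y := by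
          congr 1
          refine lintegral_congr fun y => ?_
          rw [lintegral_const_mul _ (by fun_prop), lintegral_sub_right_eq_self G y]
      _ = _ := by rw [lintegral_mul_const _ (by fun_prop), mul_assoc, ← sq]
  exact (ENNReal.pow_le_pow_left_iff two_ne_zero).1 hsq

/-- The frequency of larger modulus dominates: if `|b| ≤ |a|` then `(a + b)² ≤ 4a²`, and `4^{σ/2} =
2^σ`. -/
lemma besselWeight_add_le {σ : ℝ} (hσ : 0 ≤ σ) (ξ η : ℝ) :
    besselWeight σ (ξ + η) ≤ 2 ^ σ * (besselWeight σ ξ + besselWeight σ η) := by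
  have key (a b : ℝ) (h : |b| ≤ |a|) : besselWeight σ (a + b) ≤ 2 ^ σ * besselWeight σ a := by
    have e : (2 : ℝ) ^ σ = (2 ^ 2 : ℝ) ^ (σ / 2) := by
      rw [← Real.rpow_natCast, ← Real.rpow_mul (by norm_num)]
      congr 1; push_cast; ring
    unfold besselWeight
    rw [e, ← Real.mul_rpow (by norm_num) (by positivity)]
    refine Real.rpow_le_rpow (by positivity) ?_ (by linarith)
    have hab : (a + b) ^ 2 ≤ 4 * a ^ 2 := by
      have := sq_le_sq.2 h
      nlinarith [sq_nonneg (a - b)]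
    have : (2 * Real.pi * (a + b)) ^ 2 ≤ 4 * (2 * Real.pi * a) ^ 2 := by
      rw [mul_pow, mul_pow _ a]; nlinarith [sq_nonneg (2 * Real.pi)]
    linarith
  have h0 : (0 : ℝ) ≤ 2 ^ σ := by positivity
  have p1 := besselWeight_pos σ ξ
  have p2 := besselWeight_pos σ η
  rcases le_total |η| |ξ| with h | h
  · exact (key ξ η h).trans (mul_le_mul_of_nonneg_left (by linarith) h0)
  · rw [add_comm ξ]
    exact (key η ξ h).trans (mul_le_mul_of_nonneg_left (by linarith) h0)

open scoped Convolution

/-- Convolution of complex functions on the real line. -/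
def conv (a b : ℝ → ℂ) : ℝ → ℂ := a ⋆[ContinuousLinearMap.mul ℂ ℂ] b

lemma conv_apply (a b : ℝ → ℂ) (ξ : ℝ) : conv a b ξ = ∫ η, a η * b (ξ - η) := rfl

lemma measurable_conv {a b : ℝ → ℂ} (ha : Measurable a) (hb : Measurable b) :
    Measurable (conv a b) := by
  have : StronglyMeasurable fun p : ℝ × ℝ => a p.2 * b (p.1 - p.2) :=
    Measurable.stronglyMeasurable (by fun_prop)
  exact this.integral_prod_right'.measurable

lemma fourierInv_conv {a b : ℝ → ℂ} (ha : Integrable a volume) (hb : Integrable b volume) :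
    𝓕⁻ (conv a b) = 𝓕⁻ a * 𝓕⁻ b := by
  ext x
  simp only [Pi.mul_apply, Real.fourierInv_eq_fourier_neg]
  exact Real.fourier_mul_convolution_eq ha hb (-x)

/-- By `besselWeight_add_le` the weight at `ξ = η + (ξ - η)` is carried by one of the two factors.
Young's inequality then takes the weighted factor in `L²` and the other in `L¹`. -/
lemma weightedENorm_conv_le {σ : ℝ} (hσ : 0 ≤ σ) {a b : ℝ → ℂ} (ha : Measurable a)
    (hb : Measurable b) :
    weightedENorm σ (conv a b) ≤ ENNReal.ofReal (2 ^ σ) *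
      (weightedENorm σ a * eLpNorm b 1 volume + eLpNorm a 1 volume * weightedENorm σ b) := by
  set A : ℝ → ℝ≥0∞ := fun ξ => ‖(besselWeight σ ξ : ℂ) * a ξ‖ₑ
  set B : ℝ → ℝ≥0∞ := fun ξ => ‖(besselWeight σ ξ : ℂ) * b ξ‖ₑ
  have hw : Measurable fun ξ => (besselWeight σ ξ : ℂ) :=
    Complex.measurable_ofReal.comp (measurable_besselWeight σ)
  have hA : Measurable A := (hw.mul ha).enorm
  have hB : Measurable B := (hw.mul hb).enorm
  have hA' : Measurable fun ξ => ‖a ξ‖ₑ := ha.enorm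
  have hB' : Measurable fun ξ => ‖b ξ‖ₑ := hb.enorm
  have hpt (ξ : ℝ) : ‖(besselWeight σ ξ : ℂ) * conv a b ξ‖ₑ ≤ ENNReal.ofReal (2 ^ σ) *
      ((∫⁻ η, A η * ‖b (ξ - η)‖ₑ) + ∫⁻ η, B η * ‖a (ξ - η)‖ₑ) := by
    have hswap : ∫⁻ η, B η * ‖a (ξ - η)‖ₑ = ∫⁻ η, ‖a η‖ₑ * B (ξ - η) := by
      -- The substitution `η ↦ ξ - η` makes the second term a convolution led by its weighted
      -- factor, as Young's inequality requires.
      rw [← lintegral_sub_left_eq_self (fun η => B η * ‖a (ξ - η)‖ₑ) ξ]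
      simp [mul_comm]
    rw [hswap, ← lintegral_add_left (by fun_prop), ← lintegral_const_mul _ (by fun_prop),
      conv_apply, ← integral_const_mul]
    refine (enorm_integral_le_lintegral_enorm _).trans (lintegral_mono fun η => ?_)
    have h := besselWeight_add_le hσ η (ξ - η)
    rw [add_sub_cancel] at h
    have e (z : ℂ) (ζ : ℝ) : ‖(besselWeight σ ζ : ℂ) * z‖ₑ = ENNReal.ofReal (besselWeight σ ζ)
        * ‖z‖ₑ := by
      rw [enorm_mul, ← ofReal_norm (besselWeight σ ζ : ℂ), norm_ofReal_besselWeight]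
    simp only [A, B, e]
    rw [enorm_mul]
    calc ENNReal.ofReal (besselWeight σ ξ) * (‖a η‖ₑ * ‖b (ξ - η)‖ₑ)
        ≤ ENNReal.ofReal (2 ^ σ * (besselWeight σ η + besselWeight σ (ξ - η)))
          * (‖a η‖ₑ * ‖b (ξ - η)‖ₑ) := by gcongr
      _ = _ := by
        rw [ENNReal.ofReal_mul (by positivity),
          ENNReal.ofReal_add (besselWeight_pos _ _).le (besselWeight_pos _ _).le]
        ring
  have hm {F G : ℝ → ℝ≥0∞} (hF : Measurable F) (hG : Measurable G) :
      Measurable fun ξ => ∫⁻ η, F η * G (ξ - η) :=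
    Measurable.lintegral_prod_right' (f := fun p : ℝ × ℝ => F p.2 * G (p.1 - p.2)) (by fun_prop)
  have hadd {F G : ℝ → ℝ≥0∞} (hF : Measurable F) (hG : Measurable G) :
      eLpNorm (F + G) 2 volume ≤ eLpNorm F 2 volume + eLpNorm G 2 volume :=
    eLpNorm_add_le hF.aestronglyMeasurable hG.aestronglyMeasurable one_le_two
  have hA2 : eLpNorm A 2 volume = weightedENorm σ a := eLpNorm_enorm _
  have hB2 : eLpNorm B 2 volume = weightedENorm σ b := eLpNorm_enorm _
  have h1 := eLpNorm_lintegral_conv_le hA hB'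
  have h2 := eLpNorm_lintegral_conv_le hB hA'
  have m1 := hm hA hB'
  have m2 := hm hB hA'
  rw [← eLpNorm_one_eq_lintegral_enorm, hA2] at h1
  rw [← eLpNorm_one_eq_lintegral_enorm, hB2] at h2
  set P : ℝ → ℝ≥0∞ := fun ξ => ∫⁻ η, A η * ‖b (ξ - η)‖ₑ
  set Q : ℝ → ℝ≥0∞ := fun ξ => ∫⁻ η, B η * ‖a (ξ - η)‖ₑ
  have h3 : weightedENorm σ (conv a b)
      ≤ eLpNorm (fun ξ => ENNReal.ofReal (2 ^ σ) * (P + Q) ξ) 2 volume :=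
    eLpNorm_mono_enorm fun ξ => by rw [enorm_eq_self]; exact hpt ξ
  have h4 : eLpNorm (fun ξ => ENNReal.ofReal (2 ^ σ) * (P + Q) ξ) 2 volume
      = ENNReal.ofReal (2 ^ σ) * eLpNorm (P + Q) 2 volume := by
    -- Homogeneity for `ℝ≥0∞`-valued functions is read off from the squares, which are plain
    -- integrals.
    refine (ENNReal.pow_right_strictMono two_ne_zero).injective ?_
    simp only [mul_pow, eLpNorm_two_sq, enorm_eq_self]
    exact lintegral_const_mul _ ((m1.add m2).pow_const 2)
  rw [h4] at h3
  refine h3.trans (mul_le_mul_right ((hadd m1 m2).trans (add_le_add h1 ?_)) _)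
  rwa [mul_comm]

/-- The constant of the algebra property of `H^σ`. -/
def algebraConst (σ : ℝ) : ℝ≥0∞ := ENNReal.ofReal (2 ^ σ) * (2 * sobolevConst)

lemma algebraConst_lt_top (σ : ℝ) : algebraConst σ < ⊤ :=
  ENNReal.mul_lt_top ENNReal.ofReal_lt_top (ENNReal.mul_lt_top (by simp) sobolevConst_lt_top)

lemma weightedENorm_conv_le' {σ : ℝ} (hσ : 1 ≤ σ) {a b : ℝ → ℂ} (ha : Measurable a)
    (hb : Measurable b) : weightedENorm σ (conv a b)
      ≤ algebraConst σ * (weightedENorm σ a * weightedENorm σ b) := by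
  refine (weightedENorm_conv_le (by linarith) ha hb).trans ?_
  rw [algebraConst, mul_assoc]
  gcongr
  calc _ ≤ weightedENorm σ a * (sobolevConst * weightedENorm σ b)
        + (sobolevConst * weightedENorm σ a) * weightedENorm σ b := by
        gcongr
        · exact eLpNorm_one_le hσ hb.aestronglyMeasurable
        · exact eLpNorm_one_le hσ ha.aestronglyMeasurable
    _ = _ := by ring

lemma HasSpectrum.mul {σ : ℝ} (hσ : 1 ≤ σ) {f g a b : ℝ → ℂ} (hf : HasSpectrum σ f a)
    (hg : HasSpectrum σ g b) : HasSpectrum σ (f * g) (conv a b) :=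
  ⟨measurable_conv hf.1 hg.1, (weightedENorm_conv_le' hσ hf.1 hg.1).trans_lt
    (ENNReal.mul_lt_top (algebraConst_lt_top σ) (ENNReal.mul_lt_top hf.2 hg.2)), by
    rw [fourierInv_conv (hf.integrable hσ) (hg.integrable hσ), ← hf.3, ← hg.3]⟩

lemma sobolevENorm_mul_le {σ : ℝ} (hσ : 1 ≤ σ) {f g : ℝ → ℂ} (hf : Continuous f)
    (hg : Continuous g) (hf' : sobolevENorm σ f < ⊤) (hg' : sobolevENorm σ g < ⊤) :
    sobolevENorm σ (f * g) ≤ algebraConst σ * (sobolevENorm σ f * sobolevENorm σ g) := by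
  have h1 := hasSpectrum_l2Fourier hσ hf hf'
  have h2 := hasSpectrum_l2Fourier hσ hg hg'
  rw [(h1.mul hσ h2).sobolevENorm_eq hσ, h1.sobolevENorm_eq hσ, h2.sobolevENorm_eq hσ]
  exact weightedENorm_conv_le' hσ h1.1 h2.1

/-! ### The operator `Λ^{-2} ∂ₓ` -/

/-- The symbol of `Λ^{-2} ∂ₓ`. -/
def smoothSymbol (ξ : ℝ) : ℂ := (((1 + (2 * Real.pi * ξ) ^ 2)⁻¹ : ℝ) : ℂ) * derivSymbol ξ

/-- With `w` the weight of order one, the symbol has modulus `|2πξ| / w² ≤ 1/w`: the operator gains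
one Sobolev order. -/
lemma norm_smoothSymbol_mul_le (σ ξ : ℝ) :
    ‖smoothSymbol ξ‖ * besselWeight (σ + 1) ξ ≤ besselWeight σ ξ := by
  have h0 : 0 < 1 + (2 * Real.pi * ξ) ^ 2 := by positivity
  rw [smoothSymbol, norm_mul, norm_derivSymbol, Complex.norm_real,
    Real.norm_of_nonneg (inv_nonneg.2 h0.le), ← besselWeight_one_sq, besselWeight_add]
  have h1 := besselWeight_pos 1 ξ
  have h2 := besselWeight_pos σ ξ
  have h3 := abs_le_besselWeight_one ξ
  calc (besselWeight 1 ξ ^ 2)⁻¹ * |2 * Real.pi * ξ| * (besselWeight σ ξ * besselWeight 1 ξ)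
      ≤ (besselWeight 1 ξ ^ 2)⁻¹ * besselWeight 1 ξ * (besselWeight σ ξ * besselWeight 1 ξ) := by
        gcongr
    _ = besselWeight σ ξ := by field_simp

lemma measurable_smoothSymbol : Measurable smoothSymbol := by
  unfold smoothSymbol
  refine Measurable.mul ?_ continuous_derivSymbol.measurable
  fun_prop

/-- Order two for `f` leaves order one for `deriv f`, which is enough to identify the `L²` transform
of the derivative with `derivSymbol` times the spectrum. From here on `Λ^{-2} ∂ₓ` is a single
multiplier acting on `f`. -/
lemma HasSpectrum.invHelmholtz_deriv {σ : ℝ} (hσ : 2 ≤ σ) {f g : ℝ → ℂ}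
    (h : HasSpectrum σ f g) :
    HasSpectrum (σ + 1) (invHelmholtz (_root_.deriv f)) (fun ξ => smoothSymbol ξ * g ξ) := by
  refine ⟨measurable_smoothSymbol.mul h.1,
    (weightedENorm_mul_le g (norm_smoothSymbol_mul_le σ)).trans_lt h.2, ?_⟩
  have h' : HasSpectrum 1 (_root_.deriv f) _ :=
    HasSpectrum.deriv (σ := 1) (h.mono (by linarith)) le_rfl
  ext x
  refine Real.fourierInv_congr_ae ?_ x
  filter_upwards [h'.l2Fourier_eq le_rfl] with ξ hξ
  rw [hξ, smoothSymbol]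
  ring

lemma sobolevENorm_invHelmholtz_deriv_le {σ : ℝ} (hσ : 2 ≤ σ) {f : ℝ → ℂ} (hc : Continuous f)
    (hf : sobolevENorm σ f < ⊤) :
    sobolevENorm (σ + 1) (invHelmholtz (deriv f)) ≤ sobolevENorm σ f := by
  have h := hasSpectrum_l2Fourier (by linarith) hc hf
  rw [(h.invHelmholtz_deriv hσ).sobolevENorm_eq (by linarith), h.sobolevENorm_eq (by linarith)]
  exact weightedENorm_mul_le _ (norm_smoothSymbol_mul_le σ)

lemma fourierInv_add {a b : ℝ → ℂ} (ha : Integrable a volume) (hb : Integrable b volume) :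
    𝓕⁻ (a + b) = 𝓕⁻ a + 𝓕⁻ b := by
  ext x
  simp only [Pi.add_apply, Real.fourierInv_eq_fourier_neg, Real.fourier_eq, smul_add]
  exact integral_add ((Real.fourierIntegral_convergent_iff (-x)).2 ha)
    ((Real.fourierIntegral_convergent_iff (-x)).2 hb)

lemma fourierInv_smul (c : ℂ) (a : ℝ → ℂ) : 𝓕⁻ (c • a) = c • 𝓕⁻ a := by
  ext x
  simp only [Pi.smul_apply, Real.fourierInv_eq_fourier_neg, Real.fourier_eq, smul_comm _ c,
    integral_smul]

lemma invHelmholtz_deriv_add {f g : ℝ → ℂ} (hf : Continuous f) (hg : Continuous g)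
    (hf' : sobolevENorm 2 f < ⊤) (hg' : sobolevENorm 2 g < ⊤) :
    invHelmholtz (deriv (f + g)) = invHelmholtz (deriv f) + invHelmholtz (deriv g) := by
  have h1 := hasSpectrum_l2Fourier one_le_two hf hf'
  have h2 := hasSpectrum_l2Fourier one_le_two hg hg'
  have h3 := hasSpectrum_l2Fourier one_le_two (hf.add hg)
    ((sobolevENorm_add_le 2 f g).trans_lt (ENNReal.add_lt_top.2 ⟨hf', hg'⟩))
  rw [(h1.invHelmholtz_deriv le_rfl).3, (h2.invHelmholtz_deriv le_rfl).3,
    (h3.invHelmholtz_deriv le_rfl).3, ← fourierInv_add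
    ((h1.invHelmholtz_deriv le_rfl).integrable (by norm_num))
    ((h2.invHelmholtz_deriv le_rfl).integrable (by norm_num))]
  ext x
  refine Real.fourierInv_congr_ae ?_ x
  filter_upwards [l2Fourier_add (h1.memLp one_le_two) (h2.memLp one_le_two)] with ξ hξ
  have hξ' : l2Fourier (f + g) ξ = l2Fourier f ξ + l2Fourier g ξ := hξ
  rw [hξ', Pi.add_apply, mul_add]

lemma invHelmholtz_deriv_smul (c : ℂ) {f : ℝ → ℂ} (hf : Continuous f)
    (hf' : sobolevENorm 2 f < ⊤) :
    invHelmholtz (deriv (c • f)) = c • invHelmholtz (deriv f) := by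
  have h1 := hasSpectrum_l2Fourier one_le_two hf hf'
  have h3 := hasSpectrum_l2Fourier one_le_two (hf.const_smul c) (by
    have := sobolevENorm_smul 2 c f
    exact this.trans_lt (ENNReal.mul_lt_top enorm_lt_top hf'))
  rw [(h1.invHelmholtz_deriv le_rfl).3, ← fourierInv_smul]
  refine (h3.invHelmholtz_deriv le_rfl).3.trans ?_
  ext x
  refine Real.fourierInv_congr_ae ?_ x
  filter_upwards [l2Fourier_smul c (h1.memLp one_le_two)] with ξ hξ
  have hξ' : l2Fourier (c • f) ξ = c * l2Fourier f ξ := hξ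
  rw [hξ', Pi.smul_apply, smul_eq_mul]
  ring

/-- Both sides are multipliers on the spectrum of `f`, so `Λ^{-2} ∂ₓ` commutes with `∂ₓ`; this
carries its Sobolev bound to all iterated derivatives. -/
lemma hasDerivAt_invHelmholtz_deriv {f : ℝ → ℂ} (hf : Continuous f)
    (hf' : sobolevENorm 2 f < ⊤) (hd : Continuous (deriv f)) (hd' : sobolevENorm 2 (deriv f) < ⊤)
    (x : ℝ) : HasDerivAt (invHelmholtz (deriv f)) (invHelmholtz (deriv (deriv f)) x) x := by
  have h := hasSpectrum_l2Fourier one_le_two hf hf'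
  have h1 := hasSpectrum_l2Fourier one_le_two hd hd'
  have h2 : HasSpectrum 1 (deriv f) _ :=
    HasSpectrum.deriv (σ := 1) (h.mono (by norm_num)) le_rfl
  have h3 := HasSpectrum.hasDerivAt (σ := 2) (h.invHelmholtz_deriv le_rfl |>.mono (by norm_num))
    one_le_two x
  rw [(h1.invHelmholtz_deriv le_rfl).3]
  refine h3.congr_deriv (Real.fourierInv_congr_ae ?_ x)
  filter_upwards [h2.l2Fourier_eq le_rfl] with ξ hξ
  rw [hξ]
  ring

/-- `Λ^{-2} ∂ₓ` maps real-valued functions to real-valued functions. -/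
lemma im_invHelmholtz_deriv {f : ℝ → ℂ} (hf : Continuous f) (hf' : sobolevENorm 2 f < ⊤)
    (hr : ∀ x, (f x).im = 0) (x : ℝ) : (invHelmholtz (deriv f) x).im = 0 := by
  have h := hasSpectrum_l2Fourier one_le_two hf hf'
  set g := l2Fourier f
  have hconj (k : ℝ → ℂ) (x : ℝ) :
      𝓕⁻ (fun ξ => (starRingEnd ℂ) (k (-ξ))) x = (starRingEnd ℂ) (𝓕⁻ k x) := by
    rw [Real.fourierInv_eq', Real.fourierInv_eq', ← integral_conj, ← integral_neg_eq_self]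
    refine integral_congr_ae (ae_of_all _ fun ξ => ?_)
    simp [← Complex.exp_conj, map_ofNat]
  -- A real `f` also has the spectrum `conj (g (-ξ))`; the spectrum is unique almost everywhere, so
  -- `g` is Hermitian, and the symbol of `Λ^{-2} ∂ₓ` has the same symmetry.
  have hg : HasSpectrum 2 f (fun ξ => (starRingEnd ℂ) (g (-ξ))) := by
    refine ⟨by have := h.1; fun_prop, ?_, ?_⟩
    · have e : weightedENorm 2 (fun ξ => (starRingEnd ℂ) (g (-ξ))) = weightedENorm 2 g := by
        refine (ENNReal.pow_right_strictMono two_ne_zero).injective ?_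
        simp only [weightedENorm, eLpNorm_two_sq]
        rw [← lintegral_neg_eq_self]
        simp [enorm_mul, besselWeight]
      rw [e]; exact h.2
    · ext x
      rw [hconj, ← h.3, Complex.conj_eq_iff_im.2 (hr x)]
  have e : g =ᵐ[volume] fun ξ => (starRingEnd ℂ) (g (-ξ)) := hg.l2Fourier_eq one_le_two
  rw [← Complex.conj_eq_iff_im, (h.invHelmholtz_deriv le_rfl).3, ← hconj]
  refine Real.fourierInv_congr_ae ?_ x
  filter_upwards [e] with ξ hξ
  rw [map_mul, ← hξ]
  congr 1
  simp [smoothSymbol, derivSymbol, map_ofNat]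

/-! ### Series and finite sums in `H^σ` -/

lemma sobolevENorm_zero (σ : ℝ) : sobolevENorm σ 0 = 0 := by
  simpa using sobolevENorm_smul σ 0 0

lemma sobolevENorm_sum_le {ι : Type*} (σ : ℝ) (s : Finset ι) (f : ι → ℝ → ℂ) :
    sobolevENorm σ (∑ i ∈ s, f i) ≤ ∑ i ∈ s, sobolevENorm σ (f i) :=
  Finset.le_sum_of_subadditive _ (sobolevENorm_zero σ).le (sobolevENorm_add_le σ) s f

lemma weightedENorm_sum_le {ι : Type*} {σ : ℝ} (s : Finset ι) {g : ι → ℝ → ℂ}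
    (hg : ∀ i, Measurable (g i)) :
    weightedENorm σ (fun ξ => ∑ i ∈ s, g i ξ) ≤ ∑ i ∈ s, weightedENorm σ (g i) := by
  have e : (fun ξ => (besselWeight σ ξ : ℂ) * ∑ i ∈ s, g i ξ)
      = ∑ i ∈ s, fun ξ => (besselWeight σ ξ : ℂ) * g i ξ := by
    ext ξ; simp [Finset.mul_sum]
  unfold weightedENorm
  rw [e]
  exact eLpNorm_sum_le (fun i _ =>
    aestronglyMeasurable_ofReal_besselWeight_mul σ (hg i).aestronglyMeasurable) one_le_two

/-- The series is summed on the Fourier side. Summable norms make the spectra summable in `L¹`,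
which gives both almost everywhere convergence and the exchange of sum and integral needed to
recognize the pointwise sum. -/
lemma sobolevENorm_tsum_le {σ : ℝ} (hσ : 1 ≤ σ) {f : ℕ → ℝ → ℂ} (hc : ∀ n, Continuous (f n))
    (hf : ∑' n, sobolevENorm σ (f n) ≠ ⊤) :
    sobolevENorm σ (fun x => ∑' n, f n x) ≤ ∑' n, sobolevENorm σ (f n) := by
  have hn (n : ℕ) : sobolevENorm σ (f n) < ⊤ := (ENNReal.ne_top_of_tsum_ne_top hf n).lt_top
  set g : ℕ → ℝ → ℂ := fun n => l2Fourier (f n)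
  have hg (n : ℕ) : HasSpectrum σ (f n) (g n) := hasSpectrum_l2Fourier hσ (hc n) (hn n)
  have hW (n : ℕ) : sobolevENorm σ (f n) = weightedENorm σ (g n) := (hg n).sobolevENorm_eq hσ
  have hL1 : ∑' n, ∫⁻ ξ, ‖g n ξ‖ₑ ≠ ⊤ := by
    refine ne_top_of_le_ne_top (ENNReal.mul_ne_top sobolevConst_lt_top.ne hf) ?_
    rw [← ENNReal.tsum_mul_left]
    refine ENNReal.tsum_le_tsum fun n => ?_
    rw [hW, ← eLpNorm_one_eq_lintegral_enorm]
    exact eLpNorm_one_le hσ (hg n).1.aestronglyMeasurable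
  have hae : ∀ᵐ ξ : ℝ, Summable fun n => g n ξ := by
    have h : ∫⁻ ξ, ∑' n, ‖g n ξ‖ₑ ≠ ⊤ := by
      rwa [lintegral_tsum fun n => (hg n).1.enorm.aemeasurable]
    filter_upwards [ae_lt_top' (AEMeasurable.tsum fun n => (hg n).1.enorm.aemeasurable) h] with ξ h
    exact Summable.of_nnnorm (ENNReal.tsum_coe_ne_top_iff_summable.1 h.ne)
  set G : ℝ → ℂ := fun ξ => ∑' n, g n ξ
  have hGm : Measurable G := Measurable.tsum fun n => (hg n).1
  have hGW : weightedENorm σ G ≤ ∑' n, weightedENorm σ (g n) := by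
    -- Fatou's lemma for the partial sums.
    refine (Lp.eLpNorm_lim_le_liminf_eLpNorm
      (f := fun N ξ => (besselWeight σ ξ : ℂ) * ∑ n ∈ Finset.range N, g n ξ) (fun N => ?_) _
      ?_).trans ?_
    · exact aestronglyMeasurable_ofReal_besselWeight_mul σ
        (Finset.measurable_fun_sum _ fun n _ => (hg n).1).aestronglyMeasurable
    · filter_upwards [hae] with ξ h
      exact h.hasSum.tendsto_sum_nat.const_mul _
    · refine Filter.liminf_le_of_frequently_le' (Filter.Frequently.of_forall fun N => ?_)
      exact (weightedENorm_sum_le _ fun n => (hg n).1).trans (ENNReal.sum_le_tsum _)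
  simp only [hW] at hf ⊢
  have hG : HasSpectrum σ (fun x => ∑' n, f n x) G := by
    refine ⟨hGm, hGW.trans_lt hf.lt_top, ?_⟩
    ext x
    have e (k : ℝ → ℂ) : 𝓕⁻ k x = ∫ ξ : ℝ, Complex.exp (2 * Real.pi * ((ξ : ℝ) * x) * Complex.I) * k ξ := by
      rw [Real.fourierInv_eq']
      congr with ξ
      simp [mul_comm]
    have hexp (ξ : ℝ) : ‖Complex.exp (2 * Real.pi * (ξ * x) * Complex.I)‖ₑ = 1 := by
      rw [← ofReal_norm, ← ENNReal.ofReal_one]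
      congr 1
      exact_mod_cast Complex.norm_exp_ofReal_mul_I (2 * Real.pi * (ξ * x))
    rw [e]
    simp only [(hg _).3, e, G, ← tsum_mul_left]
    refine (integral_tsum (fun n => ?_) ?_).symm
    · have := (hg n).1
      exact Measurable.aestronglyMeasurable (by fun_prop)
    · simpa only [enorm_mul, hexp, one_mul] using hL1
  rw [hG.sobolevENorm_eq hσ]
  exact hGW

/-! ### Bounds in `E_{δ,σ}` -/

/-- The reciprocal of the weight `δ^k (k+1)² / k!` of the `k`-th derivative. -/
def derivBound (δ : ℝ) (k : ℕ) : ℝ := k.factorial / (δ ^ k * ((k : ℝ) + 1) ^ 2)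

lemma derivBound_pos {δ : ℝ} (hδ : 0 < δ) (k : ℕ) : 0 < derivBound δ k := by
  unfold derivBound; positivity

/-- `f` is smooth with `‖f‖_{(δ,σ)} ≤ c`. -/
structure BddE (δ σ c : ℝ) (f : ℝ → ℂ) : Prop where
  contDiff : ContDiff ℝ ∞ f
  le (k : ℕ) : sobolevENorm σ (iteratedDeriv k f) ≤ ENNReal.ofReal (c * derivBound δ k)

/-- Trades the supremum in the norm for one inequality per derivative with a real constant, the form
in which all estimates are made. -/
lemma bddE_iff {δ σ c : ℝ} (hδ : 0 < δ) {f : ℝ → ℂ} :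
    BddE δ σ c f ↔ ContDiff ℝ ∞ f ∧ eNormE δ σ f ≤ ENNReal.ofReal c := by
  have key (k : ℕ) : sobolevENorm σ (iteratedDeriv k f) ≤ ENNReal.ofReal (c * derivBound δ k) ↔
      ENNReal.ofReal (δ ^ k * ((k : ℝ) + 1) ^ 2 / (k.factorial : ℝ)) *
        sobolevENorm σ (iteratedDeriv k f) ≤ ENNReal.ofReal c := by
    have hpos : 0 < δ ^ k * ((k : ℝ) + 1) ^ 2 / (k.factorial : ℝ) := by positivity
    have e : c * derivBound δ k = (δ ^ k * ((k : ℝ) + 1) ^ 2 / (k.factorial : ℝ))⁻¹ * c := by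
      rw [derivBound, inv_div, mul_comm]
    rw [e, ENNReal.ofReal_mul (inv_nonneg.2 hpos.le), ENNReal.ofReal_inv_of_pos hpos,
      ← ENNReal.mul_le_iff_le_inv (by simpa using hpos) (by simp)]
  constructor
  · exact fun h => ⟨h.1, iSup_le fun k => (key k).1 (h.2 k)⟩
  · exact fun h => ⟨h.1, fun k => (key k).2 ((le_iSup _ k).trans h.2)⟩

lemma MemE.bddE {δ σ : ℝ} (hδ : 0 < δ) {f : ℝ → ℂ} (h : MemE δ σ f) :
    BddE δ σ (eNormE δ σ f).toReal f :=
  (bddE_iff hδ).2 ⟨h.1, (ENNReal.ofReal_toReal h.2.ne).ge⟩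

namespace BddE

variable {δ σ c c' : ℝ} {f g : ℝ → ℂ}

lemma memE (hδ : 0 < δ) (h : BddE δ σ c f) : MemE δ σ f :=
  ⟨h.1, ((bddE_iff hδ).1 h).2.trans_lt ENNReal.ofReal_lt_top⟩

lemma toReal_eNormE_le (hδ : 0 < δ) (hc : 0 ≤ c) (h : BddE δ σ c f) :
    (eNormE δ σ f).toReal ≤ c :=
  ENNReal.toReal_le_of_le_ofReal hc ((bddE_iff hδ).1 h).2

lemma lt_top (h : BddE δ σ c f) (k : ℕ) : sobolevENorm σ (iteratedDeriv k f) < ⊤ :=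
  (h.2 k).trans_lt ENNReal.ofReal_lt_top

lemma sobolevENorm_lt_top (h : BddE δ σ c f) : sobolevENorm σ f < ⊤ := by
  simpa using h.lt_top 0

lemma continuous_iteratedDeriv (h : BddE δ σ c f) (k : ℕ) : Continuous (iteratedDeriv k f) :=
  h.1.continuous_iteratedDeriv k (by exact_mod_cast le_top)

lemma contDiffAt (h : BddE δ σ c f) (k : ℕ) (x : ℝ) : ContDiffAt ℝ k f x :=
  (h.1.of_le (by exact_mod_cast le_top)).contDiffAt

lemma mono (hδ : 0 < δ) (h : BddE δ σ c f) (hc : c ≤ c') : BddE δ σ c' f :=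
  ⟨h.1, fun k => (h.2 k).trans (ENNReal.ofReal_le_ofReal
    (mul_le_mul_of_nonneg_right hc (derivBound_pos hδ k).le))⟩

lemma mono_radius {δ' : ℝ} (hδ' : 0 < δ') (hδ : δ' ≤ δ) (hc : 0 ≤ c) (h : BddE δ σ c f) :
    BddE δ' σ c f := by
  refine ⟨h.1, fun k => (h.2 k).trans (ENNReal.ofReal_le_ofReal
    (mul_le_mul_of_nonneg_left ?_ hc))⟩
  unfold derivBound
  gcongr

lemma zero : BddE δ σ c 0 := by
  refine ⟨contDiff_const, fun k => ?_⟩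
  have e : iteratedDeriv k (0 : ℝ → ℂ) = 0 := by
    ext x
    simp
  rw [e, sobolevENorm_zero]
  exact zero_le

lemma add (hδ : 0 < δ) (hc : 0 ≤ c) (hc' : 0 ≤ c') (hf : BddE δ σ c f) (hg : BddE δ σ c' g) :
    BddE δ σ (c + c') (f + g) := by
  refine ⟨hf.1.add hg.1, fun k => ?_⟩
  have e : iteratedDeriv k (f + g) = iteratedDeriv k f + iteratedDeriv k g := by
    ext x
    exact iteratedDeriv_add (hf.contDiffAt k x) (hg.contDiffAt k x)
  have := (derivBound_pos hδ k).le
  rw [e, add_mul, ENNReal.ofReal_add (by positivity) (by positivity)]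
  exact (sobolevENorm_add_le σ _ _).trans (add_le_add (hf.2 k) (hg.2 k))

lemma smul (a : ℂ) (hf : BddE δ σ c f) : BddE δ σ (‖a‖ * c) (a • f) := by
  refine ⟨hf.1.const_smul a, fun k => ?_⟩
  have e : iteratedDeriv k (a • f) = a • iteratedDeriv k f := by
    ext x
    exact iteratedDeriv_const_smul (hf.contDiffAt k x) a
  rw [e, sobolevENorm_smul, mul_assoc, ENNReal.ofReal_mul (norm_nonneg a), ofReal_norm]
  gcongr
  exact hf.2 k

lemma sum {ι : Type*} (hδ : 0 < δ) (s : Finset ι) {c : ι → ℝ} {f : ι → ℝ → ℂ}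
    (hc : ∀ i ∈ s, 0 ≤ c i) (h : ∀ i ∈ s, BddE δ σ (c i) (f i)) :
    BddE δ σ (∑ i ∈ s, c i) (∑ i ∈ s, f i) := by
  classical
  induction s using Finset.induction_on with
  | empty => exact zero
  | insert i s hi ih =>
    rw [Finset.sum_insert hi, Finset.sum_insert hi]
    simp only [Finset.mem_insert, forall_eq_or_imp] at hc h
    exact add hδ hc.1 (Finset.sum_nonneg hc.2) h.1 (ih hc.2 h.2)

/-- Differentiation as a map of order one, at the cost of a smaller radius. -/
lemma deriv {δ' : ℝ} (hδ' : 0 < δ') (hδ : δ' < δ) (hc : 0 ≤ c) (h : BddE δ σ c f) :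
    BddE δ' σ (c / (δ - δ')) (deriv f) := by
  refine ⟨(contDiff_infty_iff_deriv.1 h.1).2, fun k => ?_⟩
  rw [← iteratedDeriv_succ']
  refine (h.2 (k + 1)).trans (ENNReal.ofReal_le_ofReal ?_)
  rw [div_mul_eq_mul_div, mul_div_assoc]
  refine mul_le_mul_of_nonneg_left ?_ hc
  have hd : 0 < δ - δ' := sub_pos.2 hδ
  have hδ0 : 0 < δ := hδ'.trans hδ
  -- Mean value bound for `δ^{k+1} - δ'^{k+1}`: the factor `k + 1` from `(k + 1)! / k!` is paid for
  -- by the geometric decay `(δ'/δ)^k`, at the price `1/(δ - δ')`.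
  have key : ∀ k : ℕ, ((k : ℝ) + 1) * (δ - δ') * δ' ^ k ≤ δ ^ (k + 1) - δ' ^ (k + 1) := by
    intro k
    induction k with
    | zero => simp
    | succ k ih =>
      have h1 : 0 ≤ δ ^ (k + 1) - δ' ^ (k + 1) :=
        sub_nonneg.2 (pow_le_pow_left₀ hδ'.le hδ.le _)
      calc ((k + 1 : ℕ) + 1 : ℝ) * (δ - δ') * δ' ^ (k + 1)
          = δ' * (((k : ℝ) + 1) * (δ - δ') * δ' ^ k) + δ' ^ (k + 1) * (δ - δ') := by
            push_cast; ring
        _ ≤ δ' * (δ ^ (k + 1) - δ' ^ (k + 1)) + δ' ^ (k + 1) * (δ - δ') := by gcongr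
        _ ≤ δ * (δ ^ (k + 1) - δ' ^ (k + 1)) + δ' ^ (k + 1) * (δ - δ') := by gcongr
        _ = _ := by ring
  have hk : ((k : ℝ) + 1) * (δ - δ') * δ' ^ k ≤ δ ^ (k + 1) :=
    (key k).trans (sub_le_self _ (by positivity))
  unfold derivBound
  rw [div_div, div_le_div_iff₀ (by positivity) (by positivity), Nat.factorial_succ]
  push_cast
  calc ((k : ℝ) + 1) * k.factorial * (δ' ^ k * ((k : ℝ) + 1) ^ 2 * (δ - δ'))
      = k.factorial * (((k : ℝ) + 1) * (δ - δ') * δ' ^ k) * ((k : ℝ) + 1) ^ 2 := by ring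
    _ ≤ k.factorial * δ ^ (k + 1) * ((k : ℝ) + 1 + 1) ^ 2 := by gcongr; linarith
    _ = _ := by ring

/-- Differentiation as a loss of one Sobolev derivative. -/
lemma deriv_low (hσ : 1 ≤ σ) (h : BddE δ (σ + 1) c f) : BddE δ σ c (_root_.deriv f) := by
  refine ⟨(contDiff_infty_iff_deriv.1 h.1).2, fun k => ?_⟩
  rw [← iteratedDeriv_succ', iteratedDeriv_succ]
  exact (sobolevENorm_deriv_le hσ (h.continuous_iteratedDeriv k)).trans (h.2 k)

lemma mono_order {τ : ℝ} (hτ : 1 ≤ τ) (h : BddE δ σ c f) (hσ : τ ≤ σ) : BddE δ τ c f := by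
  refine ⟨h.1, fun k => le_trans ?_ (h.2 k)⟩
  have hs := hasSpectrum_l2Fourier (hτ.trans hσ) (h.continuous_iteratedDeriv k) (h.lt_top k)
  rw [(hs.mono hσ).sobolevENorm_eq hτ, hs.sobolevENorm_eq (hτ.trans hσ)]
  exact weightedENorm_mono hσ _

end BddE

lemma sum_range_inv_sq_le (n : ℕ) : ∑ i ∈ Finset.range (n + 1), 1 / ((i : ℝ) + 1) ^ 2 ≤ 2 := by
  -- The strengthened bound telescopes, since `1/(n+2)² ≤ 1/(n+1) - 1/(n+2)`.
  have key : ∑ i ∈ Finset.range (n + 1), 1 / ((i : ℝ) + 1) ^ 2 ≤ 2 - 1 / ((n : ℝ) + 1) := by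
    induction n with
    | zero => norm_num
    | succ n ih =>
      rw [Finset.sum_range_succ]
      have : 1 / (((n + 1 : ℕ) : ℝ) + 1) ^ 2
          ≤ 1 / ((n : ℝ) + 1) - 1 / (((n + 1 : ℕ) : ℝ) + 1) := by
        push_cast
        rw [div_sub_div _ _ (by positivity) (by positivity),
          div_le_div_iff₀ (by positivity) (by positivity)]
        nlinarith [(Nat.cast_nonneg n : (0 : ℝ) ≤ n)]
      linarith
  have : 0 ≤ 1 / ((n : ℝ) + 1) := by positivity
  linarith

/-- The weights `1/(k+1)²` form a convolution algebra up to the factor `8`. -/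
lemma sum_antidiagonal_inv_sq_le (n : ℕ) :
    ∑ p ∈ antidiagonal n, 1 / ((p.1 : ℝ) + 1) ^ 2 * (1 / ((p.2 : ℝ) + 1) ^ 2)
      ≤ 8 * (1 / ((n : ℝ) + 1) ^ 2) := by
  have hS : ∑ p ∈ antidiagonal n, 1 / ((p.1 : ℝ) + 1) ^ 2 ≤ 2 := by
    rw [Finset.Nat.sum_antidiagonal_eq_sum_range_succ_mk]
    exact sum_range_inv_sq_le n
  have hS' : ∑ p ∈ antidiagonal n, 1 / ((p.2 : ℝ) + 1) ^ 2 ≤ 2 := by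
    rw [← Finset.Nat.sum_antidiagonal_swap]
    exact hS
  have hp : ∀ p ∈ antidiagonal n,
      1 / ((p.1 : ℝ) + 1) ^ 2 * (1 / ((p.2 : ℝ) + 1) ^ 2)
        ≤ 2 * (1 / ((n : ℝ) + 1) ^ 2) *
          (1 / ((p.1 : ℝ) + 1) ^ 2 + 1 / ((p.2 : ℝ) + 1) ^ 2) := by
    intro p hp
    have hn : (n : ℝ) = p.1 + p.2 := by exact_mod_cast (Finset.HasAntidiagonal.mem_antidiagonal.1 hp).symm
    have h1 : (0 : ℝ) ≤ p.1 := Nat.cast_nonneg _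
    have h2 : (0 : ℝ) ≤ p.2 := Nat.cast_nonneg _
    have e : 1 / ((p.1 : ℝ) + 1) ^ 2 + 1 / ((p.2 : ℝ) + 1) ^ 2
        = (((p.1 : ℝ) + 1) ^ 2 + ((p.2 : ℝ) + 1) ^ 2) *
          (1 / ((p.1 : ℝ) + 1) ^ 2 * (1 / ((p.2 : ℝ) + 1) ^ 2)) := by
      field_simp
      ring
    -- This is `(p + q + 1)² ≤ 2((p + 1)² + (q + 1)²)`: one of the two indices is comparable to `n`.
    have h3 : 1 ≤ 2 * (1 / ((n : ℝ) + 1) ^ 2) *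
        (((p.1 : ℝ) + 1) ^ 2 + ((p.2 : ℝ) + 1) ^ 2) := by
      rw [hn, mul_one_div, div_mul_eq_mul_div, one_le_div (by positivity)]
      nlinarith [sq_nonneg ((p.1 : ℝ) - p.2)]
    rw [e, ← mul_assoc]
    exact le_mul_of_one_le_left (by positivity) h3
  calc _ ≤ ∑ p ∈ antidiagonal n, 2 * (1 / ((n : ℝ) + 1) ^ 2) *
          (1 / ((p.1 : ℝ) + 1) ^ 2 + 1 / ((p.2 : ℝ) + 1) ^ 2) := Finset.sum_le_sum hp
    _ = 2 * (1 / ((n : ℝ) + 1) ^ 2) * (∑ p ∈ antidiagonal n, 1 / ((p.1 : ℝ) + 1) ^ 2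
          + ∑ p ∈ antidiagonal n, 1 / ((p.2 : ℝ) + 1) ^ 2) := by
        rw [← Finset.mul_sum, Finset.sum_add_distrib]
    _ ≤ 2 * (1 / ((n : ℝ) + 1) ^ 2) * (2 + 2) := by gcongr
    _ = _ := by ring

/-- The constant of the algebra property of `E_{δ,σ}`. -/
def algebraConstE (σ : ℝ) : ℝ := 8 * (algebraConst σ).toReal

lemma algebraConstE_nonneg (σ : ℝ) : 0 ≤ algebraConstE σ := by unfold algebraConstE; positivity

namespace BddE

variable {δ σ c c' : ℝ} {f g : ℝ → ℂ}

/-- In the Leibniz formula the binomial coefficient cancels the factorials and the powers of `δ`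
combine, so only the convolution of the weights `1/(k+1)²` remains. This is the purpose of `(k +
1)²` in the norm. -/
lemma mul (hδ : 0 < δ) (hσ : 1 ≤ σ) (hc : 0 ≤ c) (hc' : 0 ≤ c') (hf : BddE δ σ c f)
    (hg : BddE δ σ c' g) : BddE δ σ (algebraConstE σ * (c * c')) (f * g) := by
  refine ⟨hf.1.mul hg.1, fun k => ?_⟩
  have e : iteratedDeriv k (f * g) = ∑ p ∈ antidiagonal k,
      (k.choose p.1 : ℂ) • (iteratedDeriv p.1 f * iteratedDeriv p.2 g) := by
    ext x
    rw [iteratedDeriv_mul (hf.contDiffAt k x) (hg.contDiffAt k x),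
      Finset.Nat.sum_antidiagonal_eq_sum_range_succ_mk, Finset.sum_apply]
    simp [mul_assoc]
  rw [e]
  have hterm : ∀ p ∈ antidiagonal k,
      sobolevENorm σ ((k.choose p.1 : ℂ) • (iteratedDeriv p.1 f * iteratedDeriv p.2 g))
        ≤ ENNReal.ofReal ((algebraConst σ).toReal * (c * c') * (k.factorial / δ ^ k) *
          (1 / ((p.1 : ℝ) + 1) ^ 2 * (1 / ((p.2 : ℝ) + 1) ^ 2))) := by
    intro p hp
    have hk := Finset.HasAntidiagonal.mem_antidiagonal.1 hp
    have h1 := (derivBound_pos hδ p.1).le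
    have h2 := (derivBound_pos hδ p.2).le
    have hch : (k.choose p.1 : ℝ) * (p.1.factorial * p.2.factorial) = k.factorial := by
      rw [← hk, ← mul_assoc]
      exact_mod_cast Nat.choose_symm_add (a := p.1) ▸
        Nat.add_choose_mul_factorial_mul_factorial p.1 p.2
    rw [sobolevENorm_smul]
    calc _ ≤ ‖(k.choose p.1 : ℂ)‖ₑ * (algebraConst σ *
          (ENNReal.ofReal (c * derivBound δ p.1) * ENNReal.ofReal (c' * derivBound δ p.2))) := by
          gcongr
          refine (sobolevENorm_mul_le hσ (hf.continuous_iteratedDeriv _)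
            (hg.continuous_iteratedDeriv _) (hf.lt_top _) (hg.lt_top _)).trans ?_
          gcongr
          · exact hf.2 _
          · exact hg.2 _
      _ = ENNReal.ofReal ((k.choose p.1 : ℝ) * ((algebraConst σ).toReal *
          ((c * derivBound δ p.1) * (c' * derivBound δ p.2)))) := by
          have h3 : 0 ≤ c * derivBound δ p.1 := by positivity
          generalize c * derivBound δ p.1 = X at h3
          generalize c' * derivBound δ p.2 = Y
          rw [ENNReal.ofReal_mul (by positivity), ENNReal.ofReal_mul (by positivity),
            ENNReal.ofReal_mul h3,
            ENNReal.ofReal_toReal (algebraConst_lt_top σ).ne, ← ofReal_norm]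
          simp
      _ = _ := by
          congr 1
          rw [← hch, ← hk, derivBound, derivBound, pow_add]
          field_simp
  refine (sobolevENorm_sum_le σ _ _).trans ((Finset.sum_le_sum hterm).trans ?_)
  rw [← ENNReal.ofReal_sum_of_nonneg (fun p _ => by positivity), ← Finset.mul_sum]
  refine ENNReal.ofReal_le_ofReal ?_
  calc _ ≤ (algebraConst σ).toReal * (c * c') * (k.factorial / δ ^ k) *
        (8 * (1 / ((k : ℝ) + 1) ^ 2)) := by
        gcongr
        exact sum_antidiagonal_inv_sq_le k
    _ = _ := by
        rw [algebraConstE, derivBound]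
        field_simp

lemma iteratedDeriv_invHelmholtz_deriv (hσ : 2 ≤ σ) (h : BddE δ σ c f) (k : ℕ) :
    iteratedDeriv k (invHelmholtz (_root_.deriv f))
      = invHelmholtz (_root_.deriv (iteratedDeriv k f)) := by
  have h2 := h.mono_order one_le_two hσ
  induction k with
  | zero => simp
  | succ k ih =>
    rw [iteratedDeriv_succ, ih]
    ext x
    have hd := h2.continuous_iteratedDeriv (k + 1)
    have hd' := h2.lt_top (k + 1)
    rw [iteratedDeriv_succ] at hd hd' ⊢
    exact (hasDerivAt_invHelmholtz_deriv (h2.continuous_iteratedDeriv k) (h2.lt_top k)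
      hd hd' x).deriv

lemma invHelmholtz_deriv (hσ : 2 ≤ σ) (h : BddE δ σ c f) :
    BddE δ (σ + 1) c (invHelmholtz (_root_.deriv f)) := by
  have h2 := h.mono_order one_le_two hσ
  constructor
  · refine contDiff_of_differentiable_iteratedDeriv fun k _ x => ?_
    rw [h.iteratedDeriv_invHelmholtz_deriv hσ]
    have hd := h2.continuous_iteratedDeriv (k + 1)
    have hd' := h2.lt_top (k + 1)
    rw [iteratedDeriv_succ] at hd hd'
    exact (hasDerivAt_invHelmholtz_deriv (h2.continuous_iteratedDeriv k) (h2.lt_top k)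
      hd hd' x).differentiableAt
  · intro k
    rw [h.iteratedDeriv_invHelmholtz_deriv hσ]
    exact (sobolevENorm_invHelmholtz_deriv_le hσ (h.continuous_iteratedDeriv k)
      (h.lt_top k)).trans (h.2 k)

lemma norm_iteratedDeriv_le (hσ : 1 ≤ σ) (hδ : 0 < δ) (hc : 0 ≤ c) (h : BddE δ σ c f) (k : ℕ)
    (x : ℝ) : ‖iteratedDeriv k f x‖ ≤ sobolevConst.toReal * (c * derivBound δ k) := by
  have h1 := (enorm_apply_le_sobolevENorm hσ (h.continuous_iteratedDeriv k) x).trans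
    (mul_le_mul_right (h.2 k) _)
  have := (derivBound_pos hδ k).le
  rw [← ENNReal.ofReal_toReal sobolevConst_lt_top.ne,
    ← ENNReal.ofReal_mul ENNReal.toReal_nonneg, ← ofReal_norm] at h1
  exact (ENNReal.ofReal_le_ofReal_iff (by positivity)).1 h1

/-- Absolutely convergent series in `E_{δ,σ}`. -/
lemma tsum (hσ : 1 ≤ σ) (hδ : 0 < δ) {c : ℕ → ℝ} {f : ℕ → ℝ → ℂ} (hc : ∀ n, 0 ≤ c n)
    (hs : Summable c) (h : ∀ n, BddE δ σ (c n) (f n)) :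
    BddE δ σ (∑' n, c n) (fun x => ∑' n, f n x) := by
  have hv (k : ℕ) : Summable fun n => sobolevConst.toReal * (c n * derivBound δ k) :=
    (hs.mul_right _).mul_left _
  have hb (k n : ℕ) (x : ℝ) : ‖iteratedFDeriv ℝ k (f n) x‖
      ≤ sobolevConst.toReal * (c n * derivBound δ k) := by
    rw [norm_iteratedFDeriv_eq_norm_iteratedDeriv]
    exact (h n).norm_iteratedDeriv_le hσ hδ (hc n) k x
  have hN (n : ℕ) : ContDiff ℝ (((⊤ : ℕ∞) : WithTop ℕ∞)) (f n) := (h n).1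
  refine ⟨contDiff_tsum (v := fun k n => sobolevConst.toReal * (c n * derivBound δ k)) hN
    (fun k _ => hv k) (fun k n x _ => hb k n x), fun k => ?_⟩
  have e : iteratedDeriv k (fun x => ∑' n, f n x) = fun x => ∑' n, iteratedDeriv k (f n) x := by
    ext x
    have hsum : Summable fun n => iteratedFDeriv ℝ k (f n) x :=
      Summable.of_norm_bounded (hv k) fun n => hb k n x
    rw [iteratedDeriv, iteratedFDeriv_tsum_apply
      (v := fun k n => sobolevConst.toReal * (c n * derivBound δ k)) hN
      (fun k _ => hv k) (fun k n x _ => hb k n x) (by exact_mod_cast le_top) x]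
    have := (ContinuousMultilinearMap.apply ℝ (fun _ : Fin k => ℝ) ℂ
      (fun _ => (1 : ℝ))).map_tsum hsum
    exact this
  have hd := (derivBound_pos hδ k).le
  have hle : ∑' n, sobolevENorm σ (iteratedDeriv k (f n))
      ≤ ENNReal.ofReal ((∑' n, c n) * derivBound δ k) := by
    rw [← tsum_mul_right, ENNReal.ofReal_tsum_of_nonneg
      (fun n => mul_nonneg (hc n) hd) (hs.mul_right _)]
    exact ENNReal.tsum_le_tsum fun n => (h n).2 k
  rw [e]
  exact (sobolevENorm_tsum_le hσ (fun n => (h n).continuous_iteratedDeriv k)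
    (hle.trans_lt ENNReal.ofReal_lt_top).ne).trans hle

end BddE

/-! ### Power series with values in a Banach space -/

section PowerSeries

variable {X Y Z : Type*} [NormedAddCommGroup X] [NormedSpace ℂ X] [NormedAddCommGroup Y]
  [NormedSpace ℂ Y] [NormedAddCommGroup Z] [NormedSpace ℂ Z]

/-- `f` is the sum of the power series with coefficients `a` on the disk of radius `r`. -/
def IsPowerSeries (r : ℝ) (f : ℂ → X) (a : ℕ → X) : Prop :=
  ∀ t ∈ Metric.ball (0 : ℂ) r, HasSum (fun n => t ^ n • a n) (f t)

namespace IsPowerSeries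

variable {r : ℝ} {f g : ℂ → X} {a b : ℕ → X}

/-- The formal power series with the given coefficients. -/
def formal (a : ℕ → X) : FormalMultilinearSeries ℂ ℂ X :=
  fun n => ContinuousMultilinearMap.mkPiRing ℂ (Fin n) (a n)

lemma formal_apply (a : ℕ → X) (n : ℕ) (t : ℂ) : (formal a n fun _ => t) = t ^ n • a n := by
  simp [formal]

/-- Abel's argument: the terms are bounded at a radius `ρ` between `‖t‖` and `r`, so at `t` they are
dominated by a geometric series. -/
lemma summable_norm (h : IsPowerSeries r f a) {t : ℂ} (ht : t ∈ Metric.ball (0 : ℂ) r) :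
    Summable fun n => ‖t ^ n • a n‖ := by
  rw [mem_ball_zero_iff] at ht
  obtain ⟨ρ, h1, h2⟩ := exists_between ht
  have hρ : 0 < ρ := (norm_nonneg t).trans_lt h1
  have hρ' : (ρ : ℂ) ∈ Metric.ball (0 : ℂ) r := by
    rw [mem_ball_zero_iff, Complex.norm_real, Real.norm_of_nonneg hρ.le]; exact h2
  obtain ⟨C, hC⟩ := ((h _ hρ').summable.tendsto_atTop_zero.norm.bddAbove_range)
  refine Summable.of_nonneg_of_le (fun n => norm_nonneg _) (fun n => ?_)
    ((summable_geometric_of_lt_one (r := ‖t‖ / ρ) (by positivity)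
      ((div_lt_one hρ).2 h1)).mul_left C)
  have hn : ‖(ρ : ℂ) ^ n • a n‖ ≤ C := hC ⟨n, rfl⟩
  rw [norm_smul, norm_pow, Complex.norm_real, Real.norm_of_nonneg hρ.le] at hn
  rw [norm_smul, norm_pow, div_pow]
  calc ‖t‖ ^ n * ‖a n‖ = (ρ ^ n * ‖a n‖) * (‖t‖ ^ n / ρ ^ n) := by field_simp
    _ ≤ C * (‖t‖ ^ n / ρ ^ n) := by gcongr

lemma hasFPowerSeriesOnBall (hr : 0 < r) (h : IsPowerSeries r f a) :
    HasFPowerSeriesOnBall f (formal a) 0 (ENNReal.ofReal r) := by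
  refine ⟨ENNReal.le_of_forall_nnreal_lt fun ρ hρ => ?_, by simpa using hr, fun {t} ht => ?_⟩
  · have hρ' : ((ρ : ℝ) : ℂ) ∈ Metric.ball (0 : ℂ) r := by
      rw [mem_ball_zero_iff, Complex.norm_real, Real.norm_of_nonneg ρ.coe_nonneg]
      exact (ENNReal.lt_ofReal_iff_toReal_lt ENNReal.coe_ne_top).1 hρ
    refine FormalMultilinearSeries.le_radius_of_tendsto _ (l := 0) ?_
    refine (h.summable_norm hρ').tendsto_atTop_zero.congr fun n => ?_
    simp [formal, norm_smul, mul_comm]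
  · simp only [formal_apply, zero_add]
    refine h t ?_
    rwa [Metric.eball_ofReal] at ht

lemma differentiableOn [CompleteSpace X] (h : IsPowerSeries r f a) :
    DifferentiableOn ℂ f (Metric.ball 0 r) := by
  rcases le_or_gt r 0 with hr | hr
  · rw [Metric.ball_eq_empty.2 hr]
    exact differentiableOn_empty
  · have := (h.hasFPowerSeriesOnBall hr).differentiableOn
    rwa [Metric.eball_ofReal] at this

lemma coeff_eq (hr : 0 < r) (ha : IsPowerSeries r f a) (hb : IsPowerSeries r f b) : a = b := by
  have h := (ha.hasFPowerSeriesOnBall hr).hasFPowerSeriesAt.eq_formalMultilinearSeries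
    (hb.hasFPowerSeriesOnBall hr).hasFPowerSeriesAt
  ext n
  have := congrArg (fun p : FormalMultilinearSeries ℂ ℂ X => p n fun _ => 1) h
  simpa only [formal_apply, one_pow, one_smul] using this

lemma congr (ha : IsPowerSeries r f a) (hfg : EqOn f g (Metric.ball 0 r)) :
    IsPowerSeries r g a := fun t ht => hfg ht ▸ ha t ht

lemma apply_zero (hr : 0 < r) (h : IsPowerSeries r f a) : f 0 = a 0 := by
  have h0 := h 0 (Metric.mem_ball_self hr)
  refine h0.unique ?_
  convert hasSum_ite_eq 0 (a 0) using 2 with n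
  rcases eq_or_ne n 0 with rfl | hn <;> simp [*]

lemma add (ha : IsPowerSeries r f a) (hb : IsPowerSeries r g b) :
    IsPowerSeries r (f + g) (a + b) := fun t ht => by
  simpa only [Pi.add_apply, smul_add] using (ha t ht).add (hb t ht)

lemma const_smul (c : ℂ) (ha : IsPowerSeries r f a) : IsPowerSeries r (c • f) (c • a) :=
  fun t ht => by
    simpa only [Pi.smul_apply, smul_comm c] using (ha t ht).const_smul c

lemma map (L : X →L[ℂ] Y) (ha : IsPowerSeries r f a) :
    IsPowerSeries r (fun t => L (f t)) (fun n => L (a n)) := fun t ht => by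
  simpa only [map_smul] using L.hasSum (ha t ht)

/-- The Cauchy product. -/
lemma bilin [CompleteSpace Z] (B : X →L[ℂ] Y →L[ℂ] Z) {g : ℂ → Y} {b : ℕ → Y}
    (ha : IsPowerSeries r f a) (hb : IsPowerSeries r g b) :
    IsPowerSeries r (fun t => B (f t) (g t))
      (fun n => ∑ p ∈ antidiagonal n, B (a p.1) (b p.2)) := by
  intro t ht
  have hs : Summable fun p : ℕ × ℕ => B (t ^ p.1 • a p.1) (t ^ p.2 • b p.2) := by
    refine Summable.of_norm_bounded (((ha.summable_norm ht).mul_of_nonneg (hb.summable_norm ht)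
      (fun n => norm_nonneg _) (fun n => norm_nonneg _)).mul_left ‖B‖) fun p => ?_
    rw [← mul_assoc]
    exact B.le_opNorm₂ _ _
  have hsum : HasSum (fun p : ℕ × ℕ => B (t ^ p.1 • a p.1) (t ^ p.2 • b p.2)) (B (f t) (g t)) := by
    have h1 := hs.hasSum.prod_fiberwise fun n => (B (t ^ n • a n)).hasSum (hb t ht)
    have h2 := (B.flip (g t)).hasSum (ha t ht)
    simp only [ContinuousLinearMap.flip_apply] at h2
    rw [← h1.unique h2]
    exact hs.hasSum
  -- The absolutely convergent double series is regrouped along the antidiagonals.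
  rw [← Finset.HasAntidiagonal.sigmaAntidiagonalEquivProd.hasSum_iff] at hsum
  convert hsum.sigma fun n => hasSum_fintype _ using 2 with n
  rw [Finset.smul_sum, ← Finset.sum_finset_coe]
  refine Finset.sum_congr rfl fun p _ => ?_
  have hp : (p : ℕ × ℕ).1 + (p : ℕ × ℕ).2 = n :=
    Finset.HasAntidiagonal.mem_antidiagonal.1 p.2
  simp [smul_smul, ← pow_add, hp, mul_comm]

lemma of_differentiableOn [CompleteSpace X] (h : DifferentiableOn ℂ f (Metric.ball 0 r)) :
    IsPowerSeries r f (fun n => (n.factorial : ℂ)⁻¹ • iteratedDeriv n f 0) := fun t ht => by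
  have := Complex.hasSum_taylorSeries_on_ball h ht
  simpa only [sub_zero, smul_comm (t ^ _)] using this

lemma deriv [CompleteSpace X] (h : IsPowerSeries r f a) :
    IsPowerSeries r (deriv f) (fun n => ((n : ℂ) + 1) • a (n + 1)) := by
  rcases le_or_gt r 0 with hr | hr
  · intro t ht
    simp [Metric.ball_eq_empty.2 hr] at ht
  have h1 := of_differentiableOn h.differentiableOn
  have h2 := of_differentiableOn (h.differentiableOn.deriv Metric.isOpen_ball)
  rw [h.coeff_eq hr h1]
  convert h2 using 2 with n
  rw [← iteratedDeriv_succ', smul_smul, Nat.factorial_succ]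
  congr 1
  push_cast
  have : (n : ℂ) + 1 ≠ 0 := by exact_mod_cast n.succ_ne_zero
  field_simp

/-- Coefficients of geometric growth. -/
lemma of_norm_le [CompleteSpace X] {C q : ℝ} (hq : 0 < q) (ha : ∀ n, ‖a n‖ ≤ C * q ^ n) :
    IsPowerSeries q⁻¹ (fun t => ∑' n, t ^ n • a n) a := by
  intro t ht
  rw [mem_ball_zero_iff, ← one_div, lt_div_iff₀ hq] at ht
  refine (Summable.of_norm_bounded ((summable_geometric_of_lt_one (by positivity) ht).mul_left C)
    fun n => ?_).hasSum
  rw [norm_smul, norm_pow, mul_pow]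
  calc ‖t‖ ^ n * ‖a n‖ ≤ ‖t‖ ^ n * (C * q ^ n) := by gcongr; exact ha n
    _ = _ := by ring

end IsPowerSeries

end PowerSeries

/-! ### `E_{δ,σ}` as a Banach space, and operators on it -/

namespace E

variable {δ σ δ' σ' : ℝ}

lemma bddE (hδ : 0 < δ) (f : E δ σ) : BddE δ σ ‖f‖ f := MemE.bddE hδ f.2

/-- The element of `E_{δ,σ}` given by a function. -/
def mk (f : ℝ → ℂ) (h : MemE δ σ f) : E δ σ := ⟨f, h⟩

lemma norm_mk_le {c : ℝ} (hδ : 0 < δ) (hc : 0 ≤ c) {f : ℝ → ℂ} (h : BddE δ σ c f) :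
    ‖mk f (h.memE hδ)‖ ≤ c := h.toReal_eNormE_le hδ hc

lemma coe_injective : Function.Injective fun f : E δ σ => (f : ℝ → ℂ) := Subtype.val_injective

/-- The underlying function, as a linear map. -/
def coeLM (δ σ : ℝ) : E δ σ →ₗ[ℂ] ℝ → ℂ := (submoduleE δ σ).subtype

lemma coe_add (f g : E δ σ) : ((f + g : E δ σ) : ℝ → ℂ) = f + g := rfl

lemma coe_smul (c : ℂ) (f : E δ σ) : ((c • f : E δ σ) : ℝ → ℂ) = c • (f : ℝ → ℂ) := rfl

lemma coe_sum {ι : Type*} (s : Finset ι) (f : ι → E δ σ) :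
    ((∑ i ∈ s, f i : E δ σ) : ℝ → ℂ) = ∑ i ∈ s, (f i : ℝ → ℂ) := map_sum (coeLM δ σ) f s

lemma norm_apply_le (hδ : 0 < δ) (hσ : 1 ≤ σ) (f : E δ σ) (x : ℝ) :
    ‖f x‖ ≤ sobolevConst.toReal * ‖f‖ := by
  have h := (f.bddE hδ).norm_iteratedDeriv_le hσ hδ (norm_nonneg f) 0 x
  simpa [derivBound] using h

/-- Evaluation at a point. -/
def evalCLM (hδ : 0 < δ) (hσ : 1 ≤ σ) (x : ℝ) : E δ σ →L[ℂ] ℂ :=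
  LinearMap.mkContinuous ((LinearMap.proj x : (ℝ → ℂ) →ₗ[ℂ] ℂ) ∘ₗ coeLM δ σ) sobolevConst.toReal
    fun f => f.norm_apply_le hδ hσ x

lemma evalCLM_apply (hδ : 0 < δ) (hσ : 1 ≤ σ) (x : ℝ) (f : E δ σ) :
    evalCLM hδ hσ x f = f x := rfl

/-- An absolutely convergent series has its pointwise sum as limit: `BddE.tsum`, applied to the
whole series and then to its tails, gives membership and convergence. -/
lemma completeSpace (hδ : 0 < δ) (hσ : 1 ≤ σ) : CompleteSpace (E δ σ) := by
  refine NormedAddCommGroup.completeSpace_of_summable_imp_tendsto fun u hu => ?_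
  have h := BddE.tsum hσ hδ (fun n => norm_nonneg (u n)) hu fun n => (u n).bddE hδ
  have hp (x : ℝ) : Summable fun n => u n x :=
    Summable.of_norm_bounded (hu.mul_left _) fun n => (u n).norm_apply_le hδ hσ x
  refine ⟨mk _ (h.memE hδ), ?_⟩
  rw [tendsto_iff_norm_sub_tendsto_zero]
  refine squeeze_zero (fun n => norm_nonneg _) (fun N => ?_) (tendsto_sum_nat_add fun n => ‖u n‖)
  have h' := BddE.tsum hσ hδ (fun n => norm_nonneg (u (n + N))) ((summable_nat_add_iff N).2 hu)
    fun n => (u (n + N)).bddE hδ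
  rw [← norm_neg, neg_sub]
  refine le_of_eq_of_le (congrArg norm ?_)
    (norm_mk_le hδ (tsum_nonneg fun n => norm_nonneg _) h')
  refine coe_injective (funext fun x => ?_)
  have e : (∑ i ∈ Finset.range N, u i : E δ σ) x = ∑ i ∈ Finset.range N, u i x := by
    rw [coe_sum, Finset.sum_apply]
  change (∑' n, u n x) - (∑ i ∈ Finset.range N, u i : E δ σ) x = ∑' n, u (n + N) x
  rw [e, sub_eq_iff_eq_add', (hp x).sum_add_tsum_nat_add]

/-- The continuous linear map induced by an operator on functions. -/
def lift (hδ : 0 < δ) (hδ' : 0 < δ') (T : (ℝ → ℂ) → ℝ → ℂ) (C : ℝ) (hC : 0 ≤ C)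
    (hT : ∀ c f, 0 ≤ c → BddE δ σ c f → BddE δ' σ' (C * c) (T f))
    (hadd : ∀ f g : E δ σ, T ((f : ℝ → ℂ) + (g : ℝ → ℂ)) = T f + T g)
    (hsmul : ∀ (c : ℂ) (f : E δ σ), T (c • (f : ℝ → ℂ)) = c • T f) : E δ σ →L[ℂ] E δ' σ' :=
  LinearMap.mkContinuous
    { toFun := fun f => mk (T f) ((hT _ _ (norm_nonneg f) (f.bddE hδ)).memE hδ')
      map_add' := fun f g => coe_injective (hadd f g)
      map_smul' := fun c f => coe_injective (hsmul c f) } C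
    fun f => norm_mk_le hδ' (by positivity) (hT _ _ (norm_nonneg f) (f.bddE hδ))

lemma lift_apply (hδ : 0 < δ) (hδ' : 0 < δ') (T : (ℝ → ℂ) → ℝ → ℂ) (C : ℝ) (hC : 0 ≤ C)
    (hT : ∀ c f, 0 ≤ c → BddE δ σ c f → BddE δ' σ' (C * c) (T f))
    (hadd : ∀ f g : E δ σ, T ((f : ℝ → ℂ) + (g : ℝ → ℂ)) = T f + T g)
    (hsmul : ∀ (c : ℂ) (f : E δ σ), T (c • (f : ℝ → ℂ)) = c • T f) (f : E δ σ) :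
    (lift hδ hδ' T C hC hT hadd hsmul f : ℝ → ℂ) = T f := rfl

/-- Differentiation, from `E_{δ,σ}` to `E_{δ',σ}` with `δ' < δ`. -/
def derivCLM (hδ' : 0 < δ') (hδ : δ' < δ) : E δ σ →L[ℂ] E δ' σ :=
  lift (hδ'.trans hδ) hδ' deriv (1 / (δ - δ')) (by have := sub_pos.2 hδ; positivity)
    (fun c f hc h => by
      rw [one_div_mul_eq_div]
      exact h.deriv hδ' hδ hc)
    (fun f g => funext fun x => deriv_add
      (f.2.1.differentiable (by simp)).differentiableAt
      (g.2.1.differentiable (by simp)).differentiableAt)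
    (fun c f => funext fun x => deriv_const_smul c
      (f.2.1.differentiable (by simp)).differentiableAt)

lemma derivCLM_apply (hδ' : 0 < δ') (hδ : δ' < δ) (f : E δ σ) :
    (derivCLM hδ' hδ f : ℝ → ℂ) = deriv f := lift_apply ..

/-- Differentiation, from `E_{δ,σ+1}` to `E_{δ,σ}`. -/
def derivLowCLM (hδ : 0 < δ) (hσ : 1 ≤ σ) : E δ (σ + 1) →L[ℂ] E δ σ :=
  lift hδ hδ deriv 1 zero_le_one
    (fun c f _ h => by
      rw [one_mul]
      exact h.deriv_low hσ)
    (fun f g => funext fun x => deriv_add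
      (f.2.1.differentiable (by simp)).differentiableAt
      (g.2.1.differentiable (by simp)).differentiableAt)
    (fun c f => funext fun x => deriv_const_smul c
      (f.2.1.differentiable (by simp)).differentiableAt)

lemma derivLowCLM_apply (hδ : 0 < δ) (hσ : 1 ≤ σ) (f : E δ (σ + 1)) :
    (derivLowCLM hδ hσ f : ℝ → ℂ) = deriv f := lift_apply ..

/-- The inclusion of `E_{δ,σ+1}` into `E_{δ,σ}`. -/
def inclCLM (hδ : 0 < δ) (hσ : 1 ≤ σ) : E δ (σ + 1) →L[ℂ] E δ σ :=
  lift hδ hδ id 1 zero_le_one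
    (fun c f _ h => by
      rw [one_mul]
      exact h.mono_order hσ (by linarith))
    (fun _ _ => rfl) (fun _ _ => rfl)

lemma inclCLM_apply (hδ : 0 < δ) (hσ : 1 ≤ σ) (f : E δ (σ + 1)) :
    (inclCLM hδ hσ f : ℝ → ℂ) = f := lift_apply ..

/-- The operator `Λ^{-2} ∂ₓ`, from `E_{δ,σ}` to `E_{δ,σ+1}`. -/
def smoothCLM (hδ : 0 < δ) (hσ : 2 ≤ σ) : E δ σ →L[ℂ] E δ (σ + 1) :=
  have h2 (f : E δ σ) : sobolevENorm 2 f < ⊤ :=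
    ((f.bddE hδ).mono_order one_le_two hσ).sobolevENorm_lt_top
  lift hδ hδ (fun f => invHelmholtz (deriv f)) 1 zero_le_one
    (fun c f _ h => by
      rw [one_mul]
      exact h.invHelmholtz_deriv hσ)
    (fun f g => invHelmholtz_deriv_add f.2.1.continuous g.2.1.continuous (h2 f) (h2 g))
    (fun c f => invHelmholtz_deriv_smul c f.2.1.continuous (h2 f))

lemma smoothCLM_apply (hδ : 0 < δ) (hσ : 2 ≤ σ) (f : E δ σ) :
    (smoothCLM hδ hσ f : ℝ → ℂ) = invHelmholtz (deriv f) := lift_apply ..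

/-- Multiplication in `E_{δ,σ}`. -/
def mulCLM (hδ : 0 < δ) (hσ : 1 ≤ σ) : E δ σ →L[ℂ] E δ σ →L[ℂ] E δ σ :=
  LinearMap.mkContinuous₂
    (LinearMap.mk₂ ℂ (fun f g : E δ σ => mk ((f : ℝ → ℂ) * (g : ℝ → ℂ))
        (((f.bddE hδ).mul hδ hσ (norm_nonneg f) (norm_nonneg g) (g.bddE hδ)).memE hδ))
      (fun f f' g => coe_injective (add_mul (f : ℝ → ℂ) (f' : ℝ → ℂ) (g : ℝ → ℂ)))
      (fun c f g => coe_injective (smul_mul_assoc c (f : ℝ → ℂ) (g : ℝ → ℂ)))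
      (fun f g g' => coe_injective (mul_add (f : ℝ → ℂ) (g : ℝ → ℂ) (g' : ℝ → ℂ)))
      (fun c f g => coe_injective (mul_smul_comm c (f : ℝ → ℂ) (g : ℝ → ℂ))))
    (algebraConstE σ) fun f g => by
      have := algebraConstE_nonneg σ
      rw [mul_assoc]
      exact norm_mk_le hδ (by positivity)
        ((f.bddE hδ).mul hδ hσ (norm_nonneg f) (norm_nonneg g) (g.bddE hδ))

lemma mulCLM_apply (hδ : 0 < δ) (hσ : 1 ≤ σ) (f g : E δ σ) :
    (mulCLM hδ hσ f g : ℝ → ℂ) = (f : ℝ → ℂ) * (g : ℝ → ℂ) := rfl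

end E

/-! ### The recursion for the Taylor coefficients in time -/

/-- The `n`-th Taylor coefficient of `-α u + (3-β)/2 u² + β/2 uₓ² + v + v²/2`. -/
def sourceCoeff (α β : ℝ) (u v : ℕ → ℝ → ℂ) (n : ℕ) : ℝ → ℂ :=
  -(α : ℂ) • u n + ((3 - (β : ℂ)) / 2) • (∑ p ∈ antidiagonal n, u p.1 * u p.2)
    + ((β : ℂ) / 2) • (∑ p ∈ antidiagonal n, deriv (u p.1) * deriv (u p.2)) + v n
    + (1 / 2 : ℂ) • ∑ p ∈ antidiagonal n, v p.1 * v p.2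

/-- The `n`-th Taylor coefficient of `-uₜ`. -/
def rhsU (α β : ℝ) (u v : ℕ → ℝ → ℂ) (n : ℕ) : ℝ → ℂ :=
  deriv (((β : ℂ) / 2) • ∑ p ∈ antidiagonal n, u p.1 * u p.2)
    + invHelmholtz (deriv (sourceCoeff α β u v n))

/-- The `n`-th Taylor coefficient of `-vₜ`. -/
def rhsV (u v : ℕ → ℝ → ℂ) (n : ℕ) : ℝ → ℂ :=
  deriv (u n + ∑ p ∈ antidiagonal n, u p.1 * v p.2)

/-- The sequences `u`, `v` are the Taylor coefficients of a formal solution. -/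
structure IsFormalSolution (α β : ℝ) (u v : ℕ → ℝ → ℂ) : Prop where
  eq_u (n : ℕ) : u (n + 1) = (-((n : ℂ) + 1)⁻¹) • rhsU α β u v n
  eq_v (n : ℕ) : v (n + 1) = (-((n : ℂ) + 1)⁻¹) • rhsV u v n

lemma sum_antidiagonal_congr {u u' v v' : ℕ → ℝ → ℂ} {n : ℕ} (hu : ∀ i ≤ n, u i = u' i)
    (hv : ∀ i ≤ n, v i = v' i) :
    ∑ p ∈ antidiagonal n, u p.1 * v p.2 = ∑ p ∈ antidiagonal n, u' p.1 * v' p.2 :=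
  Finset.sum_congr rfl fun p hp => by
    rw [hu _ (Finset.HasAntidiagonal.antidiagonal.fst_le hp), hv _ (Finset.HasAntidiagonal.antidiagonal.snd_le hp)]

/-- The recursion at order `n` sees only coefficients up to order `n`; existence and uniqueness of
the formal solution both rest on this. -/
lemma rhs_congr (α β : ℝ) {u u' v v' : ℕ → ℝ → ℂ} {n : ℕ} (hu : ∀ i ≤ n, u i = u' i)
    (hv : ∀ i ≤ n, v i = v' i) :
    rhsU α β u v n = rhsU α β u' v' n ∧ rhsV u v n = rhsV u' v' n := by
  have h1 := sum_antidiagonal_congr (u := fun i => deriv (u i)) (u' := fun i => deriv (u' i))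
    (v := fun i => deriv (u i)) (v' := fun i => deriv (u' i)) (n := n)
    (fun i hi => by rw [hu i hi]) (fun i hi => by rw [hu i hi])
  simp only [rhsU, rhsV, sourceCoeff, hu n le_rfl, hv n le_rfl, h1, sum_antidiagonal_congr hu hu,
    sum_antidiagonal_congr hu hv, sum_antidiagonal_congr hv hv, and_self]

lemma IsFormalSolution.unique {α β : ℝ} {u u' v v' : ℕ → ℝ → ℂ} (h : IsFormalSolution α β u v)
    (h' : IsFormalSolution α β u' v') (hu : u 0 = u' 0) (hv : v 0 = v' 0) (n : ℕ) :
    u n = u' n ∧ v n = v' n := by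
  induction n using Nat.strong_induction_on with
  | _ n ih =>
    cases n with
    | zero => exact ⟨hu, hv⟩
    | succ n =>
      have := rhs_congr α β (fun i hi => (ih i (Nat.lt_succ_of_le hi)).1)
        (fun i hi => (ih i (Nat.lt_succ_of_le hi)).2)
      rw [h.eq_u, h.eq_v, h'.eq_u, h'.eq_v, this.1, this.2]
      exact ⟨rfl, rfl⟩

/-- The first `n + 1` Taylor coefficients of the formal solution with initial value `(u₀, v₀)`. -/
def formalIter (α β : ℝ) (u₀ v₀ : ℝ → ℂ) : ℕ → ℕ → (ℝ → ℂ) × (ℝ → ℂ)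
  | 0 => fun _ => (u₀, v₀)
  -- The Cauchy products need all earlier coefficients, so the whole table is carried along and one
  -- entry is overwritten at each stage.
  | n + 1 => Function.update (formalIter α β u₀ v₀ n) (n + 1)
      ((-((n : ℂ) + 1)⁻¹) • rhsU α β (fun i => (formalIter α β u₀ v₀ n i).1)
          (fun i => (formalIter α β u₀ v₀ n i).2) n,
        (-((n : ℂ) + 1)⁻¹) • rhsV (fun i => (formalIter α β u₀ v₀ n i).1)
          (fun i => (formalIter α β u₀ v₀ n i).2) n)

lemma formalIter_eq (α β : ℝ) (u₀ v₀ : ℝ → ℂ) {k n : ℕ} (h : k ≤ n) :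
    formalIter α β u₀ v₀ n k = formalIter α β u₀ v₀ k k := by
  induction n, h using Nat.le_induction with
  | base => rfl
  | succ n hn ih => rw [formalIter, Function.update_of_ne (by omega), ih]

lemma exists_isFormalSolution (α β : ℝ) (u₀ v₀ : ℝ → ℂ) :
    ∃ u v : ℕ → ℝ → ℂ, IsFormalSolution α β u v ∧ u 0 = u₀ ∧ v 0 = v₀ := by
  set a := fun n => formalIter α β u₀ v₀ n n
  have key (n : ℕ) := rhs_congr α β (n := n)
    (u := fun i => (formalIter α β u₀ v₀ n i).1) (u' := fun i => (a i).1)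
    (v := fun i => (formalIter α β u₀ v₀ n i).2) (v' := fun i => (a i).2)
    (fun i hi => by rw [formalIter_eq α β u₀ v₀ hi]) (fun i hi => by
      rw [formalIter_eq α β u₀ v₀ hi])
  refine ⟨fun n => (a n).1, fun n => (a n).2, ⟨fun n => ?_, fun n => ?_⟩, rfl, rfl⟩
  · rw [← (key n).1]
    simp only [a]
    rw [formalIter, Function.update_self]
  · rw [← (key n).2]
    simp only [a]
    rw [formalIter, Function.update_self]

/-! ### Bounds of the Taylor coefficients -/

lemma BddE.sum_antidiagonal_mul {δ σ : ℝ} (hδ : 0 < δ) (hσ : 1 ≤ σ) {M : ℕ → ℝ}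
    (hM : ∀ i, 0 ≤ M i) {u v : ℕ → ℝ → ℂ} {n : ℕ} (hu : ∀ i ≤ n, BddE δ σ (M i) (u i))
    (hv : ∀ i ≤ n, BddE δ σ (M i) (v i)) :
    BddE δ σ (algebraConstE σ * ∑ p ∈ antidiagonal n, M p.1 * M p.2)
      (∑ p ∈ antidiagonal n, u p.1 * v p.2) := by
  rw [Finset.mul_sum]
  refine BddE.sum hδ _ (fun p _ => ?_) fun p hp => ?_
  · exact mul_nonneg (algebraConstE_nonneg σ) (mul_nonneg (hM _) (hM _))
  · exact (hu _ (Finset.HasAntidiagonal.antidiagonal.fst_le hp)).mul hδ hσ (hM _) (hM _)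
      (hv _ (Finset.HasAntidiagonal.antidiagonal.snd_le hp))

/-- The constant in the bound of the right-hand side. -/
def rhsConst (α β s : ℝ) : ℝ :=
  1 + ‖-(α : ℂ)‖ + (‖(3 - (β : ℂ)) / 2‖ + ‖(β : ℂ) / 2‖ + ‖(1 / 2 : ℂ)‖) * algebraConstE s
    + (‖(β : ℂ) / 2‖ + 1) * algebraConstE (s + 1)

lemma rhsConst_pos (α β s : ℝ) : 0 < rhsConst α β s := by
  have h1 := algebraConstE_nonneg s
  have h2 := algebraConstE_nonneg (s + 1)
  unfold rhsConst
  positivity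

section Bounds

variable {α β δ δ' s : ℝ} {M : ℕ → ℝ} {u v : ℕ → ℝ → ℂ} {n : ℕ}

/-- The bracket is estimated one Sobolev order below the solution, so that `uₓ` costs an order
rather than radius. -/
lemma bddE_sourceCoeff (hδ : 0 < δ) (hs : 2 ≤ s) (hM : ∀ i, 0 ≤ M i)
    (hu : ∀ i ≤ n, BddE δ (s + 1) (M i) (u i)) (hv : ∀ i ≤ n, BddE δ (s + 1) (M i) (v i)) :
    BddE δ s ((1 + ‖-(α : ℂ)‖) * M n
      + (‖(3 - (β : ℂ)) / 2‖ + ‖(β : ℂ) / 2‖ + ‖(1 / 2 : ℂ)‖) * algebraConstE s *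
        ∑ p ∈ antidiagonal n, M p.1 * M p.2) (sourceCoeff α β u v n) := by
  have hs1 : 1 ≤ s := by linarith
  have hS : 0 ≤ algebraConstE s * ∑ p ∈ antidiagonal n, M p.1 * M p.2 :=
    mul_nonneg (algebraConstE_nonneg s) (Finset.sum_nonneg fun p _ => mul_nonneg (hM _) (hM _))
  have hMn := hM n
  have hu' : ∀ i ≤ n, BddE δ s (M i) (u i) := fun i hi => (hu i hi).mono_order hs1 (by linarith)
  have hv' : ∀ i ≤ n, BddE δ s (M i) (v i) := fun i hi => (hv i hi).mono_order hs1 (by linarith)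
  have hd : ∀ i ≤ n, BddE δ s (M i) (deriv (u i)) := fun i hi => (hu i hi).deriv_low hs1
  have h1 := (hu' n le_rfl).smul (-(α : ℂ))
  have h2 := (BddE.sum_antidiagonal_mul hδ hs1 hM hu' hu').smul ((3 - (β : ℂ)) / 2)
  have h3 := (BddE.sum_antidiagonal_mul hδ hs1 hM hd hd).smul ((β : ℂ) / 2)
  have h5 := (BddE.sum_antidiagonal_mul hδ hs1 hM hv' hv').smul (1 / 2 : ℂ)
  have h12 := h1.add hδ (by positivity) (by positivity) h2
  have h123 := h12.add hδ (by positivity) (by positivity) h3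
  have h1234 := h123.add hδ (by positivity) hMn (hv' n le_rfl)
  have h := h1234.add hδ (by positivity) (by positivity) h5
  refine h.mono hδ (le_of_eq ?_)
  ring

/-- Only the local terms, differentiated after the product estimate, pay `1/(δ - δ')`. The nonlocal
term is bounded without loss of radius and fits under the same factor because `δ - δ' ≤ 1`. -/
lemma bddE_rhs (hδ' : 0 < δ') (hδ : δ' < δ) (hδ1 : δ ≤ 1) (hs : 2 ≤ s) (hM : ∀ i, 0 ≤ M i)
    (hu : ∀ i ≤ n, BddE δ (s + 1) (M i) (u i)) (hv : ∀ i ≤ n, BddE δ (s + 1) (M i) (v i)) :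
    BddE δ' (s + 1) (rhsConst α β s / (δ - δ') * (M n + ∑ p ∈ antidiagonal n, M p.1 * M p.2))
        (rhsU α β u v n) ∧
      BddE δ' (s + 1) (rhsConst α β s / (δ - δ') * (M n + ∑ p ∈ antidiagonal n, M p.1 * M p.2))
        (rhsV u v n) := by
  have hδ0 : 0 < δ := hδ'.trans hδ
  have hs1 : 1 ≤ s + 1 := by linarith
  have hd : 0 < δ - δ' := sub_pos.2 hδ
  have hd1 : δ - δ' ≤ 1 := by linarith
  have hA0 := algebraConstE_nonneg s
  have hA1 := algebraConstE_nonneg (s + 1)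
  have hMn := hM n
  have hsrc := bddE_sourceCoeff (α := α) (β := β) hδ0 hs hM hu hv
  have h1 := BddE.sum_antidiagonal_mul hδ0 hs1 hM hu hu
  have h2 := BddE.sum_antidiagonal_mul hδ0 hs1 hM hu hv
  have hS : 0 ≤ ∑ p ∈ antidiagonal n, M p.1 * M p.2 :=
    Finset.sum_nonneg fun p _ => mul_nonneg (hM _) (hM _)
  set S := ∑ p ∈ antidiagonal n, M p.1 * M p.2
  constructor
  · have h3 := (h1.smul ((β : ℂ) / 2)).deriv hδ' hδ (by positivity)
    have h4 := (hsrc.invHelmholtz_deriv hs).mono_radius hδ' hδ.le (by positivity)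
    refine (h3.add hδ' (by positivity) (by positivity) h4).mono hδ' ?_
    rw [div_mul_eq_mul_div, le_div_iff₀ hd, add_mul, div_mul_cancel₀ _ hd.ne']
    set c := (1 + ‖-(α : ℂ)‖) * M n
      + (‖(3 - (β : ℂ)) / 2‖ + ‖(β : ℂ) / 2‖ + ‖(1 / 2 : ℂ)‖) * algebraConstE s * S with hc
    have hc0 : 0 ≤ c := by positivity
    calc _ ≤ ‖(β : ℂ) / 2‖ * (algebraConstE (s + 1) * S) + c := by
          gcongr
          exact mul_le_of_le_one_right hc0 hd1
      -- The nonnegative remainder completes the expression to `rhsConst α β s * (M n + S)`.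
      _ ≤ ‖(β : ℂ) / 2‖ * (algebraConstE (s + 1) * S) + c +
          ((1 + ‖-(α : ℂ)‖) * S
            + (‖(3 - (β : ℂ)) / 2‖ + ‖(β : ℂ) / 2‖ + ‖(1 / 2 : ℂ)‖) * algebraConstE s * M n
            + (‖(β : ℂ) / 2‖ * M n + M n + S) * algebraConstE (s + 1)) :=
          le_add_of_nonneg_right (by positivity)
      _ = _ := by rw [hc, rhsConst]; ring
  · have h3 := ((hu n le_rfl).add hδ0 hMn (by positivity) h2).deriv hδ' hδ (by positivity)
    refine h3.mono hδ' ?_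
    rw [div_mul_eq_mul_div]
    gcongr
    calc _ ≤ M n + algebraConstE (s + 1) * S + (S + ‖-(α : ℂ)‖ * (M n + S)
            + (‖(3 - (β : ℂ)) / 2‖ + ‖(β : ℂ) / 2‖ + ‖(1 / 2 : ℂ)‖) * algebraConstE s * (M n + S)
            + ‖(β : ℂ) / 2‖ * algebraConstE (s + 1) * (M n + S)
            + algebraConstE (s + 1) * M n) := le_add_of_nonneg_right (by positivity)
      _ = _ := by rw [rhsConst]; ring

/-- The growth rate of the Taylor coefficients. -/
def growthRate (α β Δ s R : ℝ) : ℝ := 24 * rhsConst α β s * (1 + 8 * R) / Δ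

lemma growthRate_pos {Δ R : ℝ} (α β s : ℝ) (hΔ : 0 < Δ) (hR : 0 ≤ R) :
    0 < growthRate α β Δ s R := by
  have := rhsConst_pos α β s
  unfold growthRate
  positivity

/-- Majorization of the Taylor coefficients of the formal solution, with a loss in the radius of
analyticity. -/
lemma IsFormalSolution.bddE {Δ R : ℝ} (h : IsFormalSolution α β u v) (hΔ : 0 < Δ) (hΔ1 : Δ ≤ 1)
    (hs : 2 ≤ s) (hR : 0 ≤ R) (hu : BddE Δ (s + 1) R (u 0)) (hv : BddE Δ (s + 1) R (v 0)) (n : ℕ) :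
    ∀ d : ℝ, 0 < d → d < 1 →
      BddE (Δ * d) (s + 1) (R * (1 / ((n : ℝ) + 1) ^ 2) * (growthRate α β Δ s R / (1 - d)) ^ n)
          (u n) ∧
        BddE (Δ * d) (s + 1) (R * (1 / ((n : ℝ) + 1) ^ 2) * (growthRate α β Δ s R / (1 - d)) ^ n)
          (v n) := by
  have hK := growthRate_pos α β s hΔ hR
  set K := growthRate α β Δ s R with hKdef
  induction n using Nat.strong_induction_on with
  | _ n ih =>
    intro d hd0 hd1
    have hd : 0 < 1 - d := sub_pos.2 hd1
    have hΔd : 0 < Δ * d := mul_pos hΔ hd0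
    cases n with
    | zero =>
      have hle : Δ * d ≤ Δ := mul_le_of_le_one_right hΔ.le hd1.le
      simp only [CharP.cast_eq_zero, zero_add, one_pow, div_one, mul_one, pow_zero]
      exact ⟨hu.mono_radius hΔd hle hR, hv.mono_radius hΔd hle hR⟩
    | succ n =>
      -- Moving a fraction `1/(n + 2)` of the way to `1` balances the two losses: the derivative
      -- costs `(n + 2)/(Δ(1 - d))`, and `1 - d'` shrinks only by the factor `(n + 1)/(n + 2)`.
      set d' : ℝ := d + (1 - d) / (n + 2) with hd'
      have hn : (0 : ℝ) ≤ n := Nat.cast_nonneg n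
      have hdd' : d < d' := by
        have : 0 < (1 - d) / (n + 2) := by positivity
        linarith
      have h1d' : 1 - d' = (1 - d) * ((n + 1) / (n + 2)) := by
        rw [hd']; field_simp; ring
      have hd'1 : d' < 1 := by
        have : 0 < 1 - d' := by rw [h1d']; positivity
        linarith
      have h1d'0 : 0 < 1 - d' := sub_pos.2 hd'1
      set L := K / (1 - d') with hL
      have hL0 : 0 < L := by positivity
      set M : ℕ → ℝ := fun i => R * (1 / ((i : ℝ) + 1) ^ 2) * L ^ i with hM
      have hM0 : ∀ i, 0 ≤ M i := fun i => by positivity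
      have hb := bddE_rhs (α := α) (β := β) (δ := Δ * d') (δ' := Δ * d) (n := n) hΔd
        (mul_lt_mul_of_pos_left hdd' hΔ) (by nlinarith) hs hM0
        (fun i hi => (ih i (Nat.lt_succ_of_le hi) d' (hd0.trans hdd') hd'1).1)
        (fun i hi => (ih i (Nat.lt_succ_of_le hi) d' (hd0.trans hdd') hd'1).2)
      have hS : ∑ p ∈ antidiagonal n, M p.1 * M p.2
          ≤ 8 * R ^ 2 * (1 / ((n : ℝ) + 1) ^ 2) * L ^ n := by
        have e : ∀ p ∈ antidiagonal n, M p.1 * M p.2 = R ^ 2 * L ^ n *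
            (1 / ((p.1 : ℝ) + 1) ^ 2 * (1 / ((p.2 : ℝ) + 1) ^ 2)) := fun p hp => by
          rw [← Finset.HasAntidiagonal.mem_antidiagonal.1 hp, hM, pow_add]; ring
        rw [Finset.sum_congr rfl e, ← Finset.mul_sum]
        calc _ ≤ R ^ 2 * L ^ n * (8 * (1 / ((n : ℝ) + 1) ^ 2)) := by
              gcongr; exact sum_antidiagonal_inv_sq_le n
          _ = _ := by ring
      have hC := rhsConst_pos α β s
      -- The cost of replacing `1 - d'` by `1 - d` in the `n`-th power is at most `e < 3`, uniformly
      -- in `n`.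
      have hpow : (((n : ℝ) + 2) / (n + 1)) ^ n ≤ 3 := by
        have h1 : ((n : ℝ) + 2) / (n + 1) ≤ Real.exp (1 / (n + 1)) := by
          refine le_trans (le_of_eq ?_) (Real.add_one_le_exp _)
          field_simp; ring
        calc (((n : ℝ) + 2) / (n + 1)) ^ n ≤ Real.exp (1 / (n + 1)) ^ n := by gcongr
          _ = Real.exp (n * (1 / (n + 1))) := by rw [Real.exp_nat_mul]
          _ ≤ Real.exp 1 := by
              gcongr
              rw [mul_one_div, div_le_one (by positivity)]
              linarith
          _ ≤ 3 := by linarith [Real.exp_one_lt_d9]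
      have hLn : L ^ n ≤ 3 * (K / (1 - d)) ^ n := by
        have : L = (K / (1 - d)) * ((n + 2) / (n + 1)) := by
          rw [hL, h1d']; field_simp
        rw [this, mul_pow, mul_comm]
        gcongr
      have hdiff : Δ * d' - Δ * d = Δ * (1 - d) / (n + 2) := by rw [hd']; ring
      have hbound : ‖(-((n : ℂ) + 1)⁻¹)‖ * (rhsConst α β s / (Δ * d' - Δ * d) *
          (M n + ∑ p ∈ antidiagonal n, M p.1 * M p.2))
          ≤ R * (1 / (((n + 1 : ℕ) : ℝ) + 1) ^ 2) * (K / (1 - d)) ^ (n + 1) := by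
        have hnorm : ‖(-((n : ℂ) + 1)⁻¹)‖ = ((n : ℝ) + 1)⁻¹ := by
          rw [norm_neg, norm_inv]
          congr 1
          exact_mod_cast Complex.norm_natCast (n + 1)
        rw [hnorm, hdiff]
        have hMS : M n + ∑ p ∈ antidiagonal n, M p.1 * M p.2
            ≤ R * (1 + 8 * R) * (1 / ((n : ℝ) + 1) ^ 2) * (3 * (K / (1 - d)) ^ n) := by
          calc _ ≤ R * (1 / ((n : ℝ) + 1) ^ 2) * L ^ n
                + 8 * R ^ 2 * (1 / ((n : ℝ) + 1) ^ 2) * L ^ n := by gcongr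
            _ = R * (1 + 8 * R) * (1 / ((n : ℝ) + 1) ^ 2) * L ^ n := by ring
            _ ≤ _ := by gcongr
        -- The derivative loss `n + 2` meets the time-integration factor `1/(n + 1)`. Shifting the
        -- weight from index `n` to `n + 1` brings the total to a cube of a ratio at most `2`; this
        -- `8` and the `3` above make up the `24` in `growthRate`.
        have hcn : ((n : ℝ) + 2) / (n + 1) * (1 / ((n : ℝ) + 1) ^ 2)
            ≤ 8 * (1 / (((n + 1 : ℕ) : ℝ) + 1) ^ 2) := by
          have h2 : ((n : ℝ) + 2) / (n + 1) ≤ 2 := by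
            rw [div_le_iff₀ (by positivity)]; linarith
          have e : 1 / ((n : ℝ) + 1) ^ 2
              = (((n : ℝ) + 2) / (n + 1)) ^ 2 * (1 / (((n + 1 : ℕ) : ℝ) + 1) ^ 2) := by
            push_cast
            field_simp
            ring
          rw [e, ← mul_assoc, ← pow_succ']
          have : (((n : ℝ) + 2) / (n + 1)) ^ 3 ≤ 2 ^ 3 := by gcongr
          gcongr
          linarith
        calc _ ≤ ((n : ℝ) + 1)⁻¹ * (rhsConst α β s / (Δ * (1 - d) / (n + 2)) *
              (R * (1 + 8 * R) * (1 / ((n : ℝ) + 1) ^ 2) * (3 * (K / (1 - d)) ^ n))) := by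
              gcongr
          _ = (3 * rhsConst α β s * (1 + 8 * R) / (Δ * (1 - d))) * R * (K / (1 - d)) ^ n *
              (((n : ℝ) + 2) / (n + 1) * (1 / ((n : ℝ) + 1) ^ 2)) := by
              field_simp
          _ ≤ (3 * rhsConst α β s * (1 + 8 * R) / (Δ * (1 - d))) * R * (K / (1 - d)) ^ n *
              (8 * (1 / (((n + 1 : ℕ) : ℝ) + 1) ^ 2)) := by gcongr
          _ = _ := by
              rw [pow_succ (K / (1 - d)), hKdef, growthRate]
              field_simp
              ring
      rw [h.eq_u, h.eq_v]
      exact ⟨(hb.1.smul _).mono hΔd hbound, (hb.2.smul _).mono hΔd hbound⟩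

end Bounds

/-! ### Real-valued solutions -/

lemma im_deriv_eq_zero {f : ℝ → ℂ} (hf : ∀ x, (f x).im = 0) (x : ℝ) : (deriv f x).im = 0 := by
  by_cases h : DifferentiableAt ℝ f x
  · have h1 := Complex.imCLM.hasFDerivAt.comp_hasDerivAt x h.hasDerivAt
    have e : Complex.imCLM ∘ f = fun _ => 0 := funext hf
    rw [e] at h1
    exact (h1.unique (hasDerivAt_const x (0 : ℝ)))
  · rw [deriv_zero_of_not_differentiableAt h, Complex.zero_im]

lemma im_sum_antidiagonal_mul {u v : ℕ → ℝ → ℂ} {n : ℕ} (hu : ∀ i ≤ n, ∀ x, (u i x).im = 0)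
    (hv : ∀ i ≤ n, ∀ x, (v i x).im = 0) (x : ℝ) :
    ((∑ p ∈ antidiagonal n, u p.1 * v p.2) x).im = 0 := by
  rw [Finset.sum_apply, Complex.im_sum]
  refine Finset.sum_eq_zero fun p hp => ?_
  simp [hu _ (Finset.HasAntidiagonal.antidiagonal.fst_le hp), hv _ (Finset.HasAntidiagonal.antidiagonal.snd_le hp)]

lemma im_ofReal_smul (c : ℝ) {f : ℝ → ℂ} (hf : ∀ x, (f x).im = 0) (x : ℝ) :
    (((c : ℂ) • f) x).im = 0 := by
  simp [hf x]

/-- The recursion has real coefficients and preserves real functions; the bounds serve to place the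
nonlocal source in `H²`, where `im_invHelmholtz_deriv` applies. -/
lemma IsFormalSolution.im_eq_zero {α β δ s : ℝ} {u v : ℕ → ℝ → ℂ} {M : ℕ → ℝ}
    (h : IsFormalSolution α β u v) (hδ : 0 < δ) (hs : 2 ≤ s) (hM : ∀ i, 0 ≤ M i)
    (hu : ∀ i, BddE δ (s + 1) (M i) (u i)) (hv : ∀ i, BddE δ (s + 1) (M i) (v i))
    (hu₀ : ∀ x, (u 0 x).im = 0) (hv₀ : ∀ x, (v 0 x).im = 0) (n : ℕ) :
    ∀ x, (u n x).im = 0 ∧ (v n x).im = 0 := by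
  induction n using Nat.strong_induction_on with
  | _ n ih =>
    cases n with
    | zero => exact fun x => ⟨hu₀ x, hv₀ x⟩
    | succ n =>
      have ru : ∀ i ≤ n, ∀ x, (u i x).im = 0 := fun i hi x => (ih i (Nat.lt_succ_of_le hi) x).1
      have rv : ∀ i ≤ n, ∀ x, (v i x).im = 0 := fun i hi x => (ih i (Nat.lt_succ_of_le hi) x).2
      have rd : ∀ i ≤ n, ∀ x, (deriv (u i) x).im = 0 := fun i hi => im_deriv_eq_zero (ru i hi)
      have hsrc := bddE_sourceCoeff (α := α) (β := β) (n := n) hδ hs hM (fun i _ => hu i)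
        (fun i _ => hv i)
      have c1 : (3 - (β : ℂ)) / 2 = (((3 - β) / 2 : ℝ) : ℂ) := by push_cast; ring
      have c2 : (β : ℂ) / 2 = ((β / 2 : ℝ) : ℂ) := by push_cast; ring
      have c3 : (1 / 2 : ℂ) = ((1 / 2 : ℝ) : ℂ) := by push_cast; ring
      have c4 (n : ℕ) : -((n : ℂ) + 1)⁻¹ = ((-((n : ℝ) + 1)⁻¹ : ℝ) : ℂ) := by push_cast; ring
      have c5 : -(α : ℂ) = ((-α : ℝ) : ℂ) := by push_cast; ring
      have rsrc (x : ℝ) : (sourceCoeff α β u v n x).im = 0 := by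
        rw [sourceCoeff, c1, c2, c3, c5]
        simp only [Pi.add_apply, Complex.add_im]
        rw [im_ofReal_smul _ (ru n le_rfl), im_ofReal_smul _ (im_sum_antidiagonal_mul ru ru),
          im_ofReal_smul _ (im_sum_antidiagonal_mul rd rd), rv n le_rfl,
          im_ofReal_smul _ (im_sum_antidiagonal_mul rv rv)]
        norm_num
      have rU (x : ℝ) : (rhsU α β u v n x).im = 0 := by
        rw [rhsU, Pi.add_apply, Complex.add_im, c2,
          im_deriv_eq_zero (im_ofReal_smul _ (im_sum_antidiagonal_mul ru ru)),
          im_invHelmholtz_deriv hsrc.1.continuous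
            (hsrc.mono_order one_le_two hs).sobolevENorm_lt_top rsrc, add_zero]
      have rV (x : ℝ) : (rhsV u v n x).im = 0 := by
        refine im_deriv_eq_zero (fun x => ?_) x
        rw [Pi.add_apply, Complex.add_im, ru n le_rfl, im_sum_antidiagonal_mul ru rv, add_zero]
      intro x
      rw [h.eq_u, h.eq_v, c4]
      exact ⟨im_ofReal_smul _ rU x, im_ofReal_smul _ rV x⟩

/-! ### Solutions as power series in time -/

section Solutions

variable {α β δ s r : ℝ} {f g : ℂ → E δ (s + 1)} {a b : ℕ → E δ (s + 1)}

/-- The term is assembled from bounded linear and bilinear maps between the spaces `E`, under which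
power series turn into power series and Cauchy products; evaluation at `x` makes the result scalar.
-/
lemma isPowerSeries_nonlocalTerm (hδ : 0 < δ) (hs : 2 ≤ s) (ha : IsPowerSeries r f a)
    (hb : IsPowerSeries r g b) (x : ℝ) :
    IsPowerSeries r (fun t => nonlocalTerm α β (f t) (g t) x)
      (fun n => invHelmholtz (deriv (sourceCoeff α β (fun i => a i) (fun i => b i) n)) x) := by
  have hs1 : 1 ≤ s := by linarith
  have := E.completeSpace (σ := s) hδ hs1
  have hf := ha.map (E.inclCLM hδ hs1)
  have hg := hb.map (E.inclCLM hδ hs1)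
  have hd := ha.map (E.derivLowCLM hδ hs1)
  have hsum := ((((hf.const_smul (-(α : ℂ))).add
    ((hf.bilin (E.mulCLM hδ hs1) hf).const_smul ((3 - (β : ℂ)) / 2))).add
    ((hd.bilin (E.mulCLM hδ hs1) hd).const_smul ((β : ℂ) / 2))).add hg).add
    ((hg.bilin (E.mulCLM hδ hs1) hg).const_smul (1 / 2 : ℂ))
  have hx := (hsum.map (E.smoothCLM hδ hs)).map (E.evalCLM hδ (by linarith) x)
  simp only [E.evalCLM_apply, E.smoothCLM_apply, Pi.add_apply, Pi.smul_apply, E.coe_add,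
    E.coe_smul, E.coe_sum, E.mulCLM_apply, E.inclCLM_apply, E.derivLowCLM_apply] at hx
  convert hx using 2 with t
  swap
  · rfl
  rw [nonlocalTerm]
  congr 2
  ext y
  simp only [Pi.add_apply, Pi.smul_apply, Pi.mul_apply, smul_eq_mul, sq]

lemma isPowerSeries_rhsU (hδ : 0 < δ) (hs : 2 ≤ s) (ha : IsPowerSeries r f a)
    (hb : IsPowerSeries r g b) (x : ℝ) :
    IsPowerSeries r
      (fun t => (β : ℂ) * f t x * deriv (f t) x + nonlocalTerm α β (f t) (g t) x)
      (fun n => rhsU α β (fun i => a i) (fun i => b i) n x) := by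
  have hs1 : 1 ≤ s + 1 := by linarith
  have := E.completeSpace (σ := s + 1) hδ hs1
  -- Differentiation is bounded only into a smaller radius. Half the radius is an arbitrary choice,
  -- since only the value at `x` is kept.
  have h1 := (((ha.bilin (E.mulCLM hδ hs1) ha).const_smul ((β : ℂ) / 2)).map
    (E.derivCLM (half_pos hδ) (half_lt_self hδ))).map (E.evalCLM (half_pos hδ) hs1 x)
  simp only [E.evalCLM_apply, E.derivCLM_apply, Pi.smul_apply, E.coe_smul, E.coe_sum,
    E.mulCLM_apply] at h1
  have h2 := h1.add (isPowerSeries_nonlocalTerm (α := α) (β := β) hδ hs ha hb x)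
  refine h2.congr fun t _ => ?_
  have hd : DifferentiableAt ℝ (f t) x := ((f t).2.1.differentiable (by simp)).differentiableAt
  simp only [Pi.add_apply]
  congr 1
  rw [deriv_const_smul _ (hd.mul hd), deriv_mul hd hd, smul_eq_mul]
  ring

lemma isPowerSeries_rhsV (hδ : 0 < δ) (hs : 2 ≤ s) (ha : IsPowerSeries r f a)
    (hb : IsPowerSeries r g b) (x : ℝ) :
    IsPowerSeries r (fun t => deriv (f t) x + deriv (fun y : ℝ => f t y * g t y) x)
      (fun n => rhsV (fun i => a i) (fun i => b i) n x) := by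
  have hs1 : 1 ≤ s + 1 := by linarith
  have := E.completeSpace (σ := s + 1) hδ hs1
  have h1 := ((ha.add (ha.bilin (E.mulCLM hδ hs1) hb)).map
    (E.derivCLM (half_pos hδ) (half_lt_self hδ))).map (E.evalCLM (half_pos hδ) hs1 x)
  simp only [E.evalCLM_apply, E.derivCLM_apply, Pi.add_apply, E.coe_add, E.coe_sum,
    E.mulCLM_apply] at h1
  refine h1.congr fun t _ => ?_
  have hf : DifferentiableAt ℝ (f t) x := ((f t).2.1.differentiable (by simp)).differentiableAt
  have hg : DifferentiableAt ℝ (g t) x := ((g t).2.1.differentiable (by simp)).differentiableAt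
  exact deriv_add hf (hf.mul hg)

variable {U : ℂ → E δ (s + 1) × E δ (s + 1)} {A : ℕ → E δ (s + 1) × E δ (s + 1)}
  {u₀ v₀ : ℝ → ℝ}

/-- The Cauchy problem in terms of the Taylor coefficients in time. -/
lemma isHolomorphicSolution_iff (hδ : 0 < δ) (hs : 2 ≤ s) (hr : 0 < r)
    (h : IsPowerSeries r U A) :
    IsHolomorphicSolution α β δ (s + 1) r u₀ v₀ U ↔
      IsFormalSolution α β (fun n => (A n).1) (fun n => (A n).2) ∧
        ((A 0).1 : ℝ → ℂ) = (fun x => (u₀ x : ℂ)) ∧ ((A 0).2 : ℝ → ℂ) = (fun x => (v₀ x : ℂ)) := by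
  have hs1 : 1 ≤ s + 1 := by linarith
  have := E.completeSpace (σ := s + 1) hδ hs1
  have h1 := h.map (ContinuousLinearMap.fst ℂ _ _)
  have h2 := h.map (ContinuousLinearMap.snd ℂ _ _)
  simp only [ContinuousLinearMap.coe_fst', ContinuousLinearMap.coe_snd'] at h1 h2
  have hU := isPowerSeries_rhsU (α := α) (β := β) hδ hs h1 h2
  have hV := isPowerSeries_rhsV hδ hs h1 h2
  have hd1 (x : ℝ) := (h.deriv.map (ContinuousLinearMap.fst ℂ _ _)).map (E.evalCLM hδ hs1 x)
  have hd2 (x : ℝ) := (h.deriv.map (ContinuousLinearMap.snd ℂ _ _)).map (E.evalCLM hδ hs1 x)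
  simp only [ContinuousLinearMap.coe_fst', ContinuousLinearMap.coe_snd', E.evalCLM_apply,
    Prod.smul_fst, Prod.smul_snd, E.coe_smul, Pi.smul_apply, smul_eq_mul] at hd1 hd2
  have hn (n : ℕ) : (n : ℂ) + 1 ≠ 0 := by exact_mod_cast n.succ_ne_zero
  have hzero : IsPowerSeries r (fun _ => (0 : ℂ)) (fun _ => 0) := fun t _ => by
    simp
  have h0 := h.apply_zero hr
  constructor
  · intro hsol
    refine ⟨⟨fun n => funext fun x => ?_, fun n => funext fun x => ?_⟩, ?_, ?_⟩
    -- At fixed `x` the residual of the equation is a scalar power series vanishing on the disk, so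
    -- each of its coefficients vanishes.
    · have e := ((hd1 x).add (hU x)).congr (g := fun _ => 0) fun t ht => by
        have := hsol.eq_u t ht x
        simp only [Pi.add_apply]
        rw [← this]; ring
      have := congrFun (e.coeff_eq hr hzero) n
      simp only [Pi.add_apply] at this
      rw [Pi.smul_apply, smul_eq_mul, eq_comm, neg_mul, inv_mul_eq_div, neg_eq_iff_eq_neg,
        div_eq_iff (hn n)]
      linear_combination this
    · have e := ((hd2 x).add (hV x)).congr (g := fun _ => 0) fun t ht => by
        have := hsol.eq_v t ht x
        simp only [Pi.add_apply]
        rw [← this]; ring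
      have := congrFun (e.coeff_eq hr hzero) n
      simp only [Pi.add_apply] at this
      rw [Pi.smul_apply, smul_eq_mul, eq_comm, neg_mul, inv_mul_eq_div, neg_eq_iff_eq_neg,
        div_eq_iff (hn n)]
      linear_combination this
    · rw [← h0]; exact funext hsol.init_u
    · rw [← h0]; exact funext hsol.init_v
  · rintro ⟨hA, hu, hv⟩
    refine ⟨h.differentiableOn, fun t ht x => ?_, fun t ht x => ?_, fun x => ?_, fun x => ?_⟩
    · have e := ((hd1 x).add (hU x)) t ht
      have hc : (fun n : ℕ => t ^ n • (((fun n : ℕ => ((n : ℂ) + 1) * (A (n + 1)).1 x)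
          + fun n => rhsU α β (fun i => (A i).1) (fun i => (A i).2) n x) : ℕ → ℂ) n)
          = fun _ => 0 := by
        ext n
        have := congrFun (hA.eq_u n) x
        simp only [Pi.smul_apply, smul_eq_mul] at this
        simp only [Pi.add_apply]
        rw [this]
        have := hn n
        field_simp
        simp
      rw [hc] at e
      have := e.unique hasSum_zero
      simp only [Pi.add_apply] at this
      rw [← this]; ring
    · have e := ((hd2 x).add (hV x)) t ht
      have hc : (fun n : ℕ => t ^ n • (((fun n : ℕ => ((n : ℂ) + 1) * (A (n + 1)).2 x)
          + fun n => rhsV (fun i => (A i).1) (fun i => (A i).2) n x) : ℕ → ℂ) n)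
          = fun _ => 0 := by
        ext n
        have := congrFun (hA.eq_v n) x
        simp only [Pi.smul_apply, smul_eq_mul] at this
        simp only [Pi.add_apply]
        rw [this]
        have := hn n
        field_simp
        simp
      rw [hc] at e
      have := e.unique hasSum_zero
      simp only [Pi.add_apply] at this
      rw [← this]; ring
    · rw [h0, hu]
    · rw [h0, hv]

/-- The Taylor coefficients of both solutions obey the recursion with the same initial values, and
each solution is the sum of its Taylor series on the entire disk. -/
lemma IsHolomorphicSolution.eqOn {W : ℂ → E δ (s + 1) × E δ (s + 1)} (hδ : 0 < δ) (hs : 2 ≤ s)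
    (hU : IsHolomorphicSolution α β δ (s + 1) r u₀ v₀ U)
    (hW : IsHolomorphicSolution α β δ (s + 1) r u₀ v₀ W) : EqOn W U (Metric.ball 0 r) := by
  rcases le_or_gt r 0 with hr | hr
  · simp [Metric.ball_eq_empty.2 hr]
  have := E.completeSpace (σ := s + 1) hδ (by linarith)
  have pU := IsPowerSeries.of_differentiableOn hU.holomorphic
  have pW := IsPowerSeries.of_differentiableOn hW.holomorphic
  obtain ⟨fU, u1, v1⟩ := (isHolomorphicSolution_iff hδ hs hr pU).1 hU
  obtain ⟨fW, u2, v2⟩ := (isHolomorphicSolution_iff hδ hs hr pW).1 hW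
  have key := fW.unique fU (u2.trans u1.symm) (v2.trans v1.symm)
  have e := funext fun n => Prod.ext (E.coe_injective (key n).1) (E.coe_injective (key n).2)
  intro t ht
  have h := pW t ht
  rw [e] at h
  exact h.unique (pU t ht)

end Solutions

end CamassaHolm

end

/-! ### Existence, uniqueness and reality of the solution -/

theorem theorem2p3 (α β Δ s : ℝ) (hΔ : 0 < Δ) (hΔ1 : Δ ≤ 1) (hs : 2 ≤ s) (u₀ v₀ : ℝ → ℝ)
    (hu₀ : CamassaHolm.MemE Δ (s + 1) (fun x => (u₀ x : ℂ)))
    (hv₀ : CamassaHolm.MemE Δ (s + 1) (fun x => (v₀ x : ℂ))) :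
    ∃ T : ℝ, 0 < T ∧ ∃ u v : ℂ → ℝ → ℂ,
      (∀ t : ℝ, |t| < T → ∀ x : ℝ, (u t x).im = 0 ∧ (v t x).im = 0) ∧
      ∀ d : ℝ, 0 < d → d < 1 →
        ∃ U : ℂ → CamassaHolm.E (Δ * d) (s + 1) × CamassaHolm.E (Δ * d) (s + 1),
          CamassaHolm.IsHolomorphicSolution α β (Δ * d) (s + 1) (T * (1 - d)) u₀ v₀ U ∧
          (∀ t ∈ Metric.ball (0 : ℂ) (T * (1 - d)), ∀ x : ℝ,
            (U t).1 x = u t x ∧ (U t).2 x = v t x) ∧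
          ∀ W : ℂ → CamassaHolm.E (Δ * d) (s + 1) × CamassaHolm.E (Δ * d) (s + 1),
            CamassaHolm.IsHolomorphicSolution α β (Δ * d) (s + 1) (T * (1 - d)) u₀ v₀ W →
              Set.EqOn W U (Metric.ball (0 : ℂ) (T * (1 - d))) := by

  obtain ⟨a, b, hab, ha0, hb0⟩ := CamassaHolm.exists_isFormalSolution α β (fun x => (u₀ x : ℂ))
    (fun x => (v₀ x : ℂ))
  obtain ⟨R, hR, hu, hv⟩ : ∃ R : ℝ, 0 ≤ R ∧ CamassaHolm.BddE Δ (s + 1) R (a 0) ∧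
      CamassaHolm.BddE Δ (s + 1) R (b 0) := by
    rw [ha0, hb0]
    exact ⟨_, le_max_of_le_left ENNReal.toReal_nonneg,
      (hu₀.bddE hΔ).mono hΔ (le_max_left _ _), (hv₀.bddE hΔ).mono hΔ (le_max_right _ _)⟩
  have hK := CamassaHolm.growthRate_pos α β s hΔ hR
  have hb := hab.bddE hΔ hΔ1 hs hR hu hv
  set K := CamassaHolm.growthRate α β Δ s R
  -- The coefficients grow like `(K/(1 - d))^n`, so the radius of convergence at level `d` is at
  -- least `K⁻¹(1 - d)`. The scalar series defining `u` and `v` do not depend on `d`.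
  refine ⟨K⁻¹, inv_pos.2 hK, fun t x => ∑' n, t ^ n * a n x, fun t x => ∑' n, t ^ n * b n x,
    fun t _ x => ?_, fun d hd0 hd1 => ?_⟩
  -- Reality of the coefficients can be checked at any single level; `d = 1/2` is used.
  · have hreal := hab.im_eq_zero (δ := Δ * (1 / 2)) (s := s) (by positivity) hs
      (M := fun n => R * (1 / ((n : ℝ) + 1) ^ 2) * (K / (1 - 1 / 2)) ^ n)
      (fun n => by positivity [show (0 : ℝ) < 1 - 1 / 2 by norm_num])
      (fun n => (hb n (1 / 2) (by norm_num) (by norm_num)).1)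
      (fun n => (hb n (1 / 2) (by norm_num) (by norm_num)).2)
      (fun x => by simp [ha0]) (fun x => by simp [hb0])
    have key (c : ℕ → ℝ → ℂ) (hc : ∀ n, (c n x).im = 0) :
        (∑' n, (t : ℂ) ^ n * c n x).im = 0 := by
      have e (n : ℕ) : (t : ℂ) ^ n * c n x = ((t ^ n * (c n x).re : ℝ) : ℂ) := by
        rw [Complex.ofReal_mul, Complex.ofReal_pow]
        congr 1
        exact Complex.ext rfl (hc n)
      simp only [e]
      rw [← Complex.ofReal_tsum, Complex.ofReal_im]
    exact ⟨key a fun n => (hreal n x).1, key b fun n => (hreal n x).2⟩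
  · have hδ : 0 < Δ * d := mul_pos hΔ hd0
    have h1d : 0 < 1 - d := sub_pos.2 hd1
    have hs1 : 1 ≤ s + 1 := by linarith
    have := CamassaHolm.E.completeSpace (σ := s + 1) hδ hs1
    have hq : 0 < K / (1 - d) := by positivity
    set A : ℕ → CamassaHolm.E (Δ * d) (s + 1) × CamassaHolm.E (Δ * d) (s + 1) := fun n =>
      (CamassaHolm.E.mk (a n) ((hb n d hd0 hd1).1.memE hδ),
        CamassaHolm.E.mk (b n) ((hb n d hd0 hd1).2.memE hδ)) with hA
    have hle (n : ℕ) : R * (1 / ((n : ℝ) + 1) ^ 2) * (K / (1 - d)) ^ n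
        ≤ R * (K / (1 - d)) ^ n := by
      gcongr
      refine mul_le_of_le_one_right hR ?_
      rw [div_le_one (by positivity)]
      exact one_le_pow₀ (by linarith [(Nat.cast_nonneg n : (0 : ℝ) ≤ n)])
    have hAn (n : ℕ) : ‖A n‖ ≤ R * (K / (1 - d)) ^ n :=
      max_le ((CamassaHolm.E.norm_mk_le hδ (by positivity) (hb n d hd0 hd1).1).trans (hle n))
        ((CamassaHolm.E.norm_mk_le hδ (by positivity) (hb n d hd0 hd1).2).trans (hle n))
    have hp := CamassaHolm.IsPowerSeries.of_norm_le hq hAn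
    rw [inv_div, div_eq_inv_mul] at hp
    have hsol := (CamassaHolm.isHolomorphicSolution_iff (α := α) (β := β) (u₀ := u₀) (v₀ := v₀)
      hδ hs (by positivity) hp).2 ⟨hab, ha0, hb0⟩
    refine ⟨_, hsol, fun t ht x => ⟨?_, ?_⟩, fun W hW => hsol.eqOn hδ hs hW⟩
    -- Evaluation at `x` is continuous, so the `E`-valued sum evaluates to the scalar series.
    · exact (((hp.map (ContinuousLinearMap.fst ℂ _ _)).map
        (CamassaHolm.E.evalCLM hδ hs1 x)) t ht).tsum_eq.symm
    · exact (((hp.map (ContinuousLinearMap.snd ℂ _ _)).map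
        (CamassaHolm.E.evalCLM hδ hs1 x)) t ht).tsum_eq.symm
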